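/- Setting. Let $k\ge 1$ and $1\le r\le m$ be integers with $k\mid r-1$, let $p\in(0,\tfrac12)$, $N=2^m$, and let $\mathbf Y\in\{0,1\}^{N}$, with coordinates indexed by $\{0,1\}^m$, have i.i.d. $\mathrm{Ber}(p)$ coordinates (the output of the BSC$(p)$ when the all-zeros codeword of the Reed–Muller code $\mathrm{RM}(m,r)$ is sent). Put $$p^{(i)}=\tfrac12\bigl(1-(1-2p)^{2^i}\bigr),\quad N^{(i)}=N/2^i,\quad N_k^{(j)}=N/2^{kj},\quad \overline\eta(\alpha)=\tfrac12(1-2\alpha),\quad n_{k,m}=\prod_{i=0}^{k-1}\frac{2^m-2^i}{2^k-2^i},$$ so that $n_{k,m}$ is the number of $k$-dimensional subspaces of $\{0,1\}^m=\mathbb F_2^m$. Decoder. For a $k$-dimensional subspace $\mathbb B$ of $\{0,1\}^{m_0}$ and a vector $\mathbf V$ indexed by $\{0,1\}^{m_0}$, the projection $\mathbf V_{/\mathbb B}$ is the vector whose coordinate at a coset of $\mathbb B$ is the sum modulo $2$ of the coordinates of $\mathbf V$ in that coset; the cosets are indexed linearly by $\{0,1\}^{m_0-k}$. The recursive projection-aggregation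 (RPA) decoder for $\mathrm{RM}(m_0,r_0)$, where $k\mid r_0-1$ and $r_0>1$, performs on its input $\mathbf V$ at most $M_{\mathrm{iter}}\ge 1$ iterations of the following step, stopping early once $\mathbf V$ is unchanged: for every $k$-dimensional subspace $\mathbb B$ of $\{0,1\}^{m_0}$, decode $\mathbf V_{/\mathbb B}$ to an estimate $\widehat{\mathbf V}_{/\mathbb B}$, by the RPA decoder for $\mathrm{RM}(m_0-k,r_0-k)$ if $r_0\ne k+1$ and by a maximum-likelihood decoder of the first-order code $\mathrm{RM}(m_0-k,1)$ (with any fixed rule for ties) if $r_0=k+1$; then simultaneously flip every coordinate $V_{\mathbf x}$ for which $\mathbf V_{/\mathbb B}$ and $\widehat{\mathbf V}_{/\mathbb B}$ differ at the coset $\mathbf x+\mathbb B$ for more than $n_{k,m_0}/2$ of the subspaces $\mathbb B$. Statement. Let $j\in\{1,\dots,\frac{r-k-1}{k}\}$ and let $0<\epsilon<\overline\eta(p^{(r-1)})$. Fix any sequence $\overline{\mathbb S}^{(1)},\dots,\overline{\mathbb S}^{(j-1)}$ of $k$-dimensional subspaces with $\overline{\mathbb S}^{(i)}\subseteq\{0,1\}^{m-k(i-1)}$,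 let $\widetilde{\mathbf Y}=\mathbf Y_{/(\overline{\mathbb S}^{(1)},\dots,\overline{\mathbb S}^{(j-1)})}$ be the successive projection of $\mathbf Y$ along it, and let $\mathcal G_k^{(j)}$ be the event that, for all $k$-dimensional subspaces $\mathbb S^{(j)}\subseteq\{0,1\}^{m-k(j-1)}$, the RPA decoder for $\mathrm{RM}(m-kj,r-kj)$ maps the projection $\widetilde{\mathbf Y}_{/\mathbb S^{(j)}}$ to $\mathbf 0$. Then $$\Pr\bigl[\mathcal G_k^{(j)}\bigr]\ \ge\ 1-2^{\frac{k(4-j)+r-1}{k}}\; n_{k,m}^{\frac{r-1-kj}{k}}\;\bigl(N_k^{(j)}\bigr)^2\,\exp\!\left(-\ln\!\left(\frac{1-p^{(r-k-1)}}{p^{(r-k-1)}}\right)2^{-2k-2}\,N^{(r-k-1)}\,\epsilon^2\right).$$ -/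

import Mathlib

open MeasureTheory ProbabilityTheory

noncomputable section

namespace RPA

/-- The evaluation points `{0,1}^m`, as vectors over the field with two elements. -/
abbrev Bits (m : ℕ) : Type := Fin m → ZMod 2

/-- Binary vectors of length `2^m`, with coordinates indexed by `{0,1}^m`. -/
abbrev Word (m : ℕ) : Type := Bits m → ZMod 2

/-- The `k`-dimensional subspaces of `{0,1}^m`. -/
abbrev KSub (k m : ℕ) : Type :=
  {B : Submodule (ZMod 2) (Bits m) // Module.finrank (ZMod 2) B = k}

/-- The Gaussian binomial coefficient `n_{k,m}`, the number of `k`-dimensional subspaces of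
`{0,1}^m`. -/
def gaussBinom (k m : ℕ) : ℝ :=
  ∏ i ∈ Finset.range k, ((2 : ℝ) ^ m - 2 ^ i) / ((2 : ℝ) ^ k - 2 ^ i)

/-- The Reed-Muller code `RM(m,r)`: evaluation vectors of polynomials of degree at most `r`. -/
def reedMuller (m r : ℕ) : Set (Word m) :=
  {c | ∃ f : MvPolynomial (Fin m) (ZMod 2),
    f.totalDegree ≤ r ∧ c = fun z => MvPolynomial.eval z f}

/-- `dec` is a maximum likelihood (minimum distance) decoder of the first-order codes `RM(m,1)`,
with some rule for breaking ties. -/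
def IsMLDecoder (dec : ∀ m : ℕ, Word m → Word m) : Prop :=
  ∀ (m : ℕ) (Y : Word m), dec m Y ∈ reedMuller m 1 ∧
    ∀ c ∈ reedMuller m 1, hammingDist Y (dec m Y) ≤ hammingDist Y c

/-- A choice, for every `k`-dimensional subspace `B` of every `{0,1}^m`, of a linear indexing of
the cosets of `B` by `{0,1}^(m-k)`. -/
abbrev CosetIndexing (k : ℕ) : Type :=
  ∀ (m : ℕ) (B : KSub k m), (Bits m ⧸ B.1) ≃ₗ[ZMod 2] Bits (m - k)

open Classical in
/-- The projection `Y_{/B}`: its coordinate at a coset is the sum modulo 2 of the coordinates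
of `Y` in that coset. -/
def proj {k : ℕ} (idx : CosetIndexing k) {m : ℕ} (B : KSub k m) (Y : Word m) : Word (m - k) :=
  fun z => ∑ y : Bits m with idx m B (B.1.mkQ y) = z, Y y

/-- `φ(x)`: the number of subspaces `B` for which the projection of `Y` and its estimate `Yhat B`
differ at the coset `x + B`. -/
def disagreements {k : ℕ} (idx : CosetIndexing k) {m : ℕ} (Y : Word m)
    (Yhat : KSub k m → Word (m - k)) (x : Bits m) : ℕ :=
  Nat.card {B : KSub k m //
    proj idx B Y (idx m B (B.1.mkQ x)) ≠ Yhat B (idx m B (B.1.mkQ x))}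

open Classical in
/-- The aggregation subroutine: flip the coordinate of `Y` at `x` iff `φ(x) > n_{k,m} / 2`. -/
def aggregate {k : ℕ} (idx : CosetIndexing k) {m : ℕ} (Y : Word m)
    (Yhat : KSub k m → Word (m - k)) : Word m :=
  fun x => Y x + if gaussBinom k m / 2 < (disagreements idx Y Yhat x : ℝ) then 1 else 0

/-- Iterate `step` at most the given number of times, stopping at the first fixed point. -/
def iterateUntilFixed {m : ℕ} (step : Word m → Word m) : ℕ → Word m → Word m
  | 0, Y => Y
  | t + 1, Y => if Y = step Y then Y else iterateUntilFixed step t (step Y)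

/-- The RPA decoder with `k`-dimensional subspaces and at most `Miter` iterations per call.
`decode idx dec Miter s m` decodes the code `RM(m, k * s + 1)`: for `s = 0` by the decoder `dec`
of first-order codes, and for `s + 1` by repeatedly projecting, decoding all projections as
words of `RM(m - k, k * s + 1)`, and aggregating. -/
def decode {k : ℕ} (idx : CosetIndexing k) (dec : ∀ m : ℕ, Word m → Word m) (Miter : ℕ) :
    ℕ → (m : ℕ) → Word m → Word m
  | 0, m => dec m
  | s + 1, m =>
      iterateUntilFixed
        (fun Y => aggregate idx Y (fun B => decode idx dec Miter s (m - k) (proj idx B Y))) Miter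

/-- `ProjPath k m t m'`: a sequence `S⁽¹⁾, …, S⁽ᵗ⁾` of `k`-dimensional subspaces, with `S⁽ⁱ⁾`
inside `{0,1}^(m - k (i - 1))`; here `m' = m - k t`. It describes a path from the root to a node
at level `t` of the projection-aggregation tree. -/
inductive ProjPath (k m : ℕ) : ℕ → ℕ → Type
  | root : ProjPath k m 0 m
  | snoc {t m' : ℕ} (P : ProjPath k m t m') (S : KSub k m') : ProjPath k m (t + 1) (m' - k)

/-- The iterated projection `Y_{/(S⁽¹⁾, …, S⁽ᵗ⁾)}` along a path. -/
def ProjPath.proj {k : ℕ} (idx : CosetIndexing k) {m : ℕ} :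
    {t m' : ℕ} → ProjPath k m t m' → Word m → Word m'
  | _, _, .root, Y => Y
  | _, _, .snoc P S, Y => RPA.proj idx S (ProjPath.proj idx P Y)

/-- The law of the vector received over `BSC(p)` when the all-zeros codeword of length `2^m` is
sent: independent `Ber(p)` coordinates. -/
def bscLaw (m : ℕ) (p : unitInterval) : Measure (Word m) :=
  Measure.pi fun _ => bernoulliMeasure (1 : ZMod 2) 0 p

/-- `p^{(i)} = (1 - (1 - 2p)^{2^i}) / 2`. -/
def crossover (p : ℝ) (i : ℕ) : ℝ := 1 / 2 * (1 - (1 - 2 * p) ^ (2 ^ i))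

/-- `N^{(i)} = 2^m / 2^i`; in particular `N_k^{(j)} = N^{(kj)}`. -/
def blockLength (m i : ℕ) : ℝ := (2 : ℝ) ^ m / 2 ^ i

/-- `η̄(α) = (1 - 2α) / 2`. -/
def etaBar (α : ℝ) : ℝ := 1 / 2 * (1 - 2 * α)

/-- The event `𝒢_k^{(j)}` at the node reached by the path `P = (S⁽¹⁾, …, S⁽ʲ⁻¹⁾)` of the tree of
`RM(m,r)`: the decoded estimates of all its children, which are words of the code
`RM(m - kj, r - kj)` with `r - kj = k ((r - 1) / k - j) + 1`, are zero. -/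
def allChildrenZero {k : ℕ} (idx : CosetIndexing k) (dec : ∀ m : ℕ, Word m → Word m)
    (Miter r j : ℕ) {m m' : ℕ} (P : ProjPath k m (j - 1) m') : Set (Word m) :=
  {Y | ∀ S : KSub k m',
    decode idx dec Miter ((r - 1) / k - j) (m' - k) ((P.snoc S).proj idx Y) = 0}

end RPA

end

/-! The decoder is compared with the event that every first-order decoding at the leaves below a
node returns zero and every aggregation vote on the way up is correct. Projecting Ber(q) bits along
a k-dimensional subspace sums disjoint cosets, so it gives independent bits with bias (1-2q)^(2^k)
(`map_proj`). Hence each node of the tree sees a fresh channel output, and only its length and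
crossover probability matter.

Suppose all children of a node decode to zero. Then coordinate x ends at zero as soon as `vote idx x
Y` is positive, whatever the bit at x (`aggregate_zero_apply`). The vote has mean (1-2q)^(2^k-1). A
single bit influences only the subspaces containing one fixed nonzero vector, a fraction at most
2^k/2^m (`card_mem_mul_le`). Bounded differences with a Kearns-Saul variance proxy 1/llr(q)
(`bounded_differences`) bounds the failure probability of a vote; this is where the logarithm in the
exponent comes from. One correct aggregation suffices, because zero is a fixed point of the step.

At a leaf, a maximum-likelihood error forces a bad majority on the support of a nonzero affine
function, which fills at least half the cube (`IsMLDecoder.fail_prob`). Its Chernoff rate is at most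
the square of the vote bound one level up (`chernoff_crossover_pow_le`).

Summing failures over the tree (`decode_fail_prob`) and over the children of the given node
(`allChildrenZero_prob_ge`) leaves arithmetic. The last aggregation level has the weakest exponent.
The leaf term has one factor n too many but is quadratic in the small exponential, so it is absorbed
unless the claim is trivial (`union_bound_absorb`). -/

namespace RPA

section Probability

/-! ### Signs and products of Bernoulli measures -/

/-- The nontrivial real character of `ZMod 2`. -/
noncomputable def sgn (a : ZMod 2) : ℝ := if a = 0 then 1 else -1

@[simp] lemma sgn_zero : sgn 0 = 1 := by simp [sgn]

@[simp] lemma sgn_one : sgn 1 = -1 := by simp [sgn]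

lemma zmod_two_cases (a : ZMod 2) : a = 0 ∨ a = 1 := by
  revert a; decide

lemma sgn_add (a b : ZMod 2) : sgn (a + b) = sgn a * sgn b := by
  rcases zmod_two_cases a with rfl | rfl <;> rcases zmod_two_cases b with rfl | rfl <;>
    simp [show (1 : ZMod 2) + 1 = 0 by decide]

lemma sgn_mul_self (a : ZMod 2) : sgn a * sgn a = 1 := by
  rcases zmod_two_cases a with rfl | rfl <;> simp

lemma abs_sgn (a : ZMod 2) : |sgn a| = 1 := by
  rcases zmod_two_cases a with rfl | rfl <;> simp

lemma sgn_sum {ι : Type*} (s : Finset ι) (f : ι → ZMod 2) :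
    sgn (∑ i ∈ s, f i) = ∏ i ∈ s, sgn (f i) := by
  classical
  induction s using Finset.induction_on with
  | empty => simp
  | insert a s ha ih => rw [Finset.sum_insert ha, Finset.prod_insert ha, sgn_add, ih]

/-- Independent `Ber(q)` bits indexed by `ι`. -/
noncomputable abbrev bits (ι : Type*) [Fintype ι] (q : unitInterval) : Measure (ι → ZMod 2) :=
  Measure.pi fun _ => bernoulliMeasure (1 : ZMod 2) 0 q

lemma integral_bernoulli (q : unitInterval) (f : ZMod 2 → ℝ) :
    ∫ a, f a ∂(bernoulliMeasure (1 : ZMod 2) 0 q) = (q : ℝ) * f 1 + (1 - q) * f 0 := by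
  rw [integral_bernoulliMeasure]
  simp

variable {ι : Type*} [Fintype ι]

lemma integral_bits_prod (q : unitInterval) (f : ι → ZMod 2 → ℝ) :
    ∫ Y, ∏ i, f i (Y i) ∂(bits ι q) = ∏ i, ((q : ℝ) * f i 1 + (1 - q) * f i 0) := by
  rw [integral_fintype_prod_eq_prod (μ := fun _ : ι => bernoulliMeasure (1 : ZMod 2) 0 q) f]
  simp_rw [integral_bernoulli]

lemma integral_bits_prod_finset (q : unitInterval) (T : Finset ι) (g : ZMod 2 → ℝ) :
    ∫ Y, ∏ i ∈ T, g (Y i) ∂(bits ι q) = ((q : ℝ) * g 1 + (1 - q) * g 0) ^ T.card := by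
  classical
  have h := integral_bits_prod (ι := ι) q (fun i a => if i ∈ T then g a else 1)
  have e : ∀ Y : ι → ZMod 2, ∏ i, (if i ∈ T then g (Y i) else 1) = ∏ i ∈ T, g (Y i) := by
    intro Y; rw [Finset.prod_ite_mem, Finset.univ_inter]
  simp_rw [e] at h
  rw [h, ← Finset.prod_const, ← Finset.prod_subset (Finset.subset_univ T)]
  · exact Finset.prod_congr rfl fun i hi => by simp [hi]
  · intro i _ hi; simp [hi]

lemma integral_prod_sgn (q : unitInterval) (T : Finset ι) :
    ∫ Y, ∏ i ∈ T, sgn (Y i) ∂(bits ι q) = (1 - 2 * (q : ℝ)) ^ T.card := by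
  rw [integral_bits_prod_finset]
  congr 1
  simp; ring

/-- A finite measure on binary words is determined by its Fourier coefficients. -/
lemma ext_of_integral_prod_sgn (μ ν : Measure (ι → ZMod 2)) [IsFiniteMeasure μ]
    [IsFiniteMeasure ν]
    (h : ∀ T : Finset ι, ∫ Y, ∏ i ∈ T, sgn (Y i) ∂μ = ∫ Y, ∏ i ∈ T, sgn (Y i) ∂ν) : μ = ν := by
  classical
  refine Measure.ext_of_singleton fun Z => ?_
  -- The indicator of Z is the product over i of (1 + sgn (Z i) sgn (Y i)) / 2; expanding it over
  -- subsets T writes it in characters.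
  have key : ∀ Y : ι → ZMod 2, Set.indicator {Z} (1 : (ι → ZMod 2) → ℝ) Y =
      ∑ T ∈ (Finset.univ : Finset ι).powerset,
        (∏ i ∈ T, (1 / 2 * sgn (Z i))) * (1 / 2) ^ (Finset.univ \ T).card *
          ∏ i ∈ T, sgn (Y i) := by
    intro Y
    have h1 : Set.indicator {Z} (1 : (ι → ZMod 2) → ℝ) Y =
        ∏ i, (1 / 2 * sgn (Z i) * sgn (Y i) + 1 / 2) := by
      by_cases hY : Y = Z
      · subst hY
        simp only [Set.mem_singleton_iff, Set.indicator_of_mem, Pi.one_apply]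
        symm
        refine Finset.prod_eq_one fun i _ => ?_
        rw [mul_assoc, sgn_mul_self]; norm_num
      · obtain ⟨i, hi⟩ := Function.ne_iff.1 hY
        rw [Set.indicator_of_notMem (by simpa using hY)]
        symm
        refine Finset.prod_eq_zero (Finset.mem_univ i) ?_
        rcases zmod_two_cases (Y i) with h0 | h0 <;> rcases zmod_two_cases (Z i) with h1 | h1 <;>
          rw [h0, h1] at hi ⊢ <;> simp at hi ⊢
    rw [h1, Finset.prod_add]
    refine Finset.sum_congr rfl fun T _ => ?_
    rw [Finset.prod_mul_distrib, Finset.prod_const]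
    ring
  have fin : ∀ ρ : Measure (ι → ZMod 2), IsFiniteMeasure ρ → ρ.real {Z} =
      ∑ T ∈ (Finset.univ : Finset ι).powerset,
        (∏ i ∈ T, (1 / 2 * sgn (Z i))) * (1 / 2) ^ (Finset.univ \ T).card *
          ∫ Y, ∏ i ∈ T, sgn (Y i) ∂ρ := by
    intro ρ hρ
    rw [← integral_indicator_one (MeasurableSet.singleton Z), integral_congr_ae
      (Filter.Eventually.of_forall key), integral_finsetSum _ fun T _ => Integrable.of_finite]
    exact Finset.sum_congr rfl fun T _ => integral_const_mul _ _
  have := (fin μ inferInstance).trans ((Finset.sum_congr rfl fun T _ => by rw [h T]).trans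
    (fin ν inferInstance).symm)
  rwa [measureReal_eq_measureReal_iff] at this

/-! ### A Kearns-Saul type inequality -/

/-- The log-likelihood ratio of the binary symmetric channel. -/
noncomputable def llr (q : ℝ) : ℝ := Real.log ((1 - q) / q)

lemma llr_pos {q : ℝ} (h0 : 0 < q) (h1 : q < 1 / 2) : 0 < llr q :=
  Real.log_pos (by rw [lt_div_iff₀ h0]; linarith)

/-- Noisier channels have a smaller log-likelihood ratio; this makes the deepest aggregation level
the worst one. -/
lemma llr_anti {q q' : ℝ} (h0 : 0 < q) (h : q ≤ q') (h1 : q' < 1 / 2) : llr q' ≤ llr q := by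
  unfold llr
  have h0' : 0 < q' := h0.trans_le h
  refine Real.log_le_log (div_pos (by linarith) h0') ?_
  rw [div_le_div_iff₀ h0' h0]
  nlinarith

lemma mul_exp_llr {q : ℝ} (h0 : 0 < q) (h1 : q < 1 / 2) : q * Real.exp (llr q) = 1 - q := by
  unfold llr
  rw [Real.exp_log (div_pos (by linarith) h0)]
  field_simp

/-- Hoeffding's lemma for a Bernoulli variable. -/
lemma bernoulli_mgf_le_hoeffding (q : unitInterval) (d : ℝ) :
    1 - (q : ℝ) + q * Real.exp d ≤ Real.exp (q * d + d ^ 2 / 8) := by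
  have h := (hasSubgaussianMGF_of_mem_Icc (X := fun x : ZMod 2 => if x = 1 then (1 : ℝ) else 0)
    (a := 0) (b := 1) (μ := bernoulliMeasure (1 : ZMod 2) 0 q)
    (measurable_of_finite _).aemeasurable
    (Filter.Eventually.of_forall fun x => by split_ifs <;> simp)).mgf_le d
  rw [mgf, integral_bernoulli, integral_bernoulli] at h
  simp only [if_true, zero_ne_one, if_false, mul_one, mul_zero, add_zero, zero_sub, sub_zero,
    nnnorm_one, NNReal.coe_pow, NNReal.coe_div, NNReal.coe_one, NNReal.coe_ofNat] at h
  have e1 : Real.exp (d * (1 - q)) = Real.exp d * Real.exp (-(q * d)) := by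
    rw [← Real.exp_add]; ring_nf
  have e2 : Real.exp (d * -(q : ℝ)) = Real.exp (-(q * d)) := by ring_nf
  have e3 : Real.exp (q * d) * Real.exp (-(q * d)) = 1 := by
    rw [← Real.exp_add]; simp
  rw [e1, e2] at h
  calc 1 - (q : ℝ) + q * Real.exp d
      = Real.exp (q * d) * (q * (Real.exp d * Real.exp (-(q * d))) +
          (1 - q) * Real.exp (-(q * d))) := by linear_combination (-(1 - q + q * Real.exp d)) * e3
    _ ≤ Real.exp (q * d) * Real.exp ((1 / 2) ^ 2 * d ^ 2 / 2) := by gcongr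
    _ = _ := by rw [← Real.exp_add]; ring_nf

/-- A weak form of the Kearns-Saul inequality. -/
lemma bernoulli_mgf_le (q : unitInterval) (h0 : 0 < (q : ℝ)) (h1 : (q : ℝ) < 1 / 2) (d : ℝ) :
    1 - (q : ℝ) + q * Real.exp d ≤ Real.exp (q * d + d ^ 2 / llr q) := by
  have hL := llr_pos h0 h1
  have hqL := mul_exp_llr h0 h1
  have hqd := bernoulli_mgf_le_hoeffding q d
  generalize (q : ℝ) = q at *
  set L := llr q with hLdef
  -- Hoeffding's constant 1/8 is already at most 1/L when L ≤ 8. For L > 8 the cases compare d with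
  -- 0, L/2 and L, the scale at which q * exp d reaches 1 - q.
  rcases le_or_gt L 8 with h8 | h8
  · refine hqd.trans (Real.exp_le_exp.2 ?_)
    have : d ^ 2 / 8 ≤ d ^ 2 / L := by gcongr
    linarith
  have small : q * (Real.exp d - 1 - d) ≤ d ^ 2 / L →
      1 - q + q * Real.exp d ≤ Real.exp (q * d + d ^ 2 / L) := by
    intro h
    calc 1 - q + q * Real.exp d = q * (Real.exp d - 1) + 1 := by ring
      _ ≤ Real.exp (q * (Real.exp d - 1)) := Real.add_one_le_exp _
      _ ≤ _ := Real.exp_le_exp.2 (by linarith)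
  rcases le_or_gt d 0 with hd | hd
  · apply small
    have e1 : Real.exp d * (1 - d) ≤ 1 := by
      have : 1 - d ≤ Real.exp (-d) := by linarith [Real.add_one_le_exp (-d)]
      calc Real.exp d * (1 - d) ≤ Real.exp d * Real.exp (-d) := by gcongr
        _ = 1 := by rw [← Real.exp_add]; simp
    have e2 : Real.exp d - 1 - d ≤ d ^ 2 := by
      have : 0 ≤ (d ^ 2 + 1 + d - Real.exp d) * (1 - d) := by nlinarith [sq_nonneg d]
      have := nonneg_of_mul_nonneg_left this (by linarith)
      linarith
    have e3 : q * L ≤ 1 := by nlinarith [Real.add_one_le_exp L]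
    rw [le_div_iff₀ hL]
    nlinarith [sq_nonneg d, mul_le_mul_of_nonneg_right e2 (mul_pos h0 hL).le]
  rcases le_or_gt d (L / 2) with hd2 | hd2
  · apply small
    have e1 : Real.exp d * (1 - d) ≤ 1 := by
      have : 1 - d ≤ Real.exp (-d) := by linarith [Real.add_one_le_exp (-d)]
      calc Real.exp d * (1 - d) ≤ Real.exp d * Real.exp (-d) := by gcongr
        _ = 1 := by rw [← Real.exp_add]; simp
    have e2 : Real.exp d - 1 - d ≤ d ^ 2 * Real.exp d := by nlinarith
    have e3 : L ≤ Real.exp (L / 2) := by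
      have := Real.quadratic_le_exp_of_nonneg (show 0 ≤ L / 2 by linarith)
      nlinarith
    have e4 : q * Real.exp d * L ≤ 1 := by
      have e5 : Real.exp d ≤ Real.exp (L / 2) := Real.exp_le_exp.2 hd2
      have e6 : Real.exp (L / 2) * Real.exp (L / 2) = Real.exp L := by
        rw [← Real.exp_add]; ring_nf
      calc q * Real.exp d * L ≤ q * Real.exp (L / 2) * Real.exp (L / 2) := by gcongr
        _ = 1 - q := by rw [mul_assoc, e6, hqL]
        _ ≤ 1 := by linarith
    rw [le_div_iff₀ hL]
    calc q * (Real.exp d - 1 - d) * L ≤ q * (d ^ 2 * Real.exp d) * L := by gcongr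
      _ = d ^ 2 * (q * Real.exp d * L) := by ring
      _ ≤ d ^ 2 * 1 := by gcongr
      _ = d ^ 2 := mul_one _
  -- Second-order estimates fail beyond L/2, but there d^2/L already exceeds 1, and q * exp d ≤ 1 -
  -- q bounds the left side by 2. Beyond L, even exp d ≤ exp (d^2/L).
  rcases le_or_gt d L with hd3 | hd3
  · have e1 : q * Real.exp d ≤ 1 - q := by
      rw [← hqL]; gcongr
    have e2 : 1 ≤ d ^ 2 / L := by
      rw [le_div_iff₀ hL]; nlinarith
    have e3 : d ^ 2 / L + 1 ≤ Real.exp (q * d + d ^ 2 / L) := by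
      have := Real.add_one_le_exp (q * d + d ^ 2 / L)
      have : 0 ≤ q * d := by positivity
      linarith
    linarith
  · have e1 : 1 ≤ Real.exp d := Real.one_le_exp hd.le
    have e2 : d ≤ d ^ 2 / L := by rw [le_div_iff₀ hL]; nlinarith
    calc 1 - q + q * Real.exp d ≤ Real.exp d := by nlinarith
      _ ≤ _ := Real.exp_le_exp.2 (by nlinarith)

/-! ### The bounded differences inequality -/

lemma integral_bits_succ (q : unitInterval) {n : ℕ} (f : (Fin (n + 1) → ZMod 2) → ℝ) :
    ∫ Y, f Y ∂(bits (Fin (n + 1)) q) =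
      q * ∫ Y, f (Fin.cons 1 Y) ∂(bits (Fin n) q) +
        (1 - q) * ∫ Y, f (Fin.cons 0 Y) ∂(bits (Fin n) q) := by
  have := (measurePreserving_piFinSuccAbove
    (fun _ : Fin (n + 1) => bernoulliMeasure (1 : ZMod 2) 0 q) 0).symm
  rw [← this.integral_comp', integral_prod _ Integrable.of_finite, integral_bernoulli]
  simp [MeasurableEquiv.piFinSuccAbove_symm_apply, Fin.insertNthEquiv]

/-- Condition on the first coordinate: the induction hypothesis handles each value, and the two
conditional means differ by at most c, so what remains is the two-point bound `bernoulli_mgf_le`. -/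
lemma bounded_differences_mgf_fin (q : unitInterval) (h0 : 0 < (q : ℝ)) (h1 : (q : ℝ) < 1 / 2)
    (c : ℝ) (n : ℕ) : ∀ f : (Fin n → ZMod 2) → ℝ,
    (∀ i Y, |f (Function.update Y i 1) - f (Function.update Y i 0)| ≤ c) →
    ∫ Y, Real.exp (f Y) ∂(bits (Fin n) q) ≤
      Real.exp (∫ Y, f Y ∂(bits (Fin n) q) + n * (c ^ 2 / llr q)) := by
  have hL := llr_pos h0 h1
  induction n with
  | zero =>
    intro f _
    have : ∀ Y, f Y = f 0 := fun Y => congrArg f (Subsingleton.elim _ _)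
    simp_rw [this]
    simp
  | succ n ih =>
    intro f hf
    have hcons : ∀ (b : ZMod 2),
        ∫ Y, Real.exp (f (Fin.cons b Y)) ∂(bits (Fin n) q) ≤
          Real.exp (∫ Y, f (Fin.cons b Y) ∂(bits (Fin n) q) + n * (c ^ 2 / llr q)) := by
      intro b
      refine ih (fun Y => f (Fin.cons b Y)) fun i Y => ?_
      simpa only [Fin.cons_update] using hf i.succ (Fin.cons b Y)
    set d := ∫ Y, f (Fin.cons 1 Y) ∂(bits (Fin n) q) - ∫ Y, f (Fin.cons 0 Y) ∂(bits (Fin n) q)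
      with hd
    have hdc : |d| ≤ c := by
      rw [hd, ← integral_sub Integrable.of_finite Integrable.of_finite]
      have hb : ∀ Y : Fin n → ZMod 2, ‖f (Fin.cons 1 Y) - f (Fin.cons 0 Y)‖ ≤ c := fun Y => by
        simpa [Fin.update_cons_zero] using hf 0 (Fin.cons 0 Y)
      have := norm_integral_le_of_norm_le_const (μ := bits (Fin n) q)
        (Filter.Eventually.of_forall hb)
      rwa [probReal_univ, mul_one] at this
    have hd2 : d ^ 2 / llr q ≤ c ^ 2 / llr q := by
      have := sq_le_sq' (abs_le.1 hdc).1 (abs_le.1 hdc).2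
      gcongr
    rw [integral_bits_succ, integral_bits_succ]
    have e1 := hcons 1
    have e0 := hcons 0
    have q1 : 0 ≤ 1 - (q : ℝ) := by linarith
    have hx : ∫ Y, f (Fin.cons 1 Y) ∂(bits (Fin n) q) =
        d + ∫ Y, f (Fin.cons 0 Y) ∂(bits (Fin n) q) := by rw [hd]; ring
    rw [hx] at e1 ⊢
    set a := ∫ Y, f (Fin.cons 0 Y) ∂(bits (Fin n) q)
    calc _ ≤ q * Real.exp (d + a + n * (c ^ 2 / llr q)) +
          (1 - q) * Real.exp (a + n * (c ^ 2 / llr q)) := by gcongr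
      _ = (1 - q + q * Real.exp d) * Real.exp (a + n * (c ^ 2 / llr q)) := by
          rw [add_assoc d, Real.exp_add d]; ring
      _ ≤ Real.exp (q * d + d ^ 2 / llr q) * Real.exp (a + n * (c ^ 2 / llr q)) := by
          gcongr; exact bernoulli_mgf_le q h0 h1 d
      _ ≤ _ := by
          rw [← Real.exp_add]
          refine Real.exp_le_exp.2 ?_
          push_cast
          linarith

lemma integral_bits_equiv {κ : Type*} [Fintype κ] (e : κ ≃ ι) (q : unitInterval)
    (f : (ι → ZMod 2) → ℝ) :
    ∫ Y, f Y ∂(bits ι q) = ∫ Y, f (fun i => Y (e.symm i)) ∂(bits κ q) := by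
  rw [← (measurePreserving_piCongrLeft
    (fun _ : ι => bernoulliMeasure (1 : ZMod 2) 0 q) e).integral_comp']
  congr! 3 with Y
  ext i
  obtain ⟨k, rfl⟩ := e.surjective i
  simp [MeasurableEquiv.coe_piCongrLeft, Equiv.piCongrLeft_apply_apply]

lemma bounded_differences_mgf [DecidableEq ι] (q : unitInterval) (h0 : 0 < (q : ℝ))
    (h1 : (q : ℝ) < 1 / 2) (c : ℝ) (f : (ι → ZMod 2) → ℝ)
    (hf : ∀ i Y, |f (Function.update Y i 1) - f (Function.update Y i 0)| ≤ c) :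
    ∫ Y, Real.exp (f Y) ∂(bits ι q) ≤
      Real.exp (∫ Y, f Y ∂(bits ι q) + Fintype.card ι * (c ^ 2 / llr q)) := by
  have e := (Fintype.equivFin ι).symm
  rw [integral_bits_equiv e, integral_bits_equiv e]
  refine bounded_differences_mgf_fin q h0 h1 c _ (fun Y => f fun i => Y (e.symm i)) fun i Y => ?_
  have : ∀ b, (fun j => Function.update Y i b (e.symm j)) =
      Function.update (fun j => Y (e.symm j)) (e i) b := by
    intro b; ext j
    by_cases h : j = e i
    · subst h; simp
    · rw [Function.update_of_ne h, Function.update_of_ne]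
      rwa [Ne, Equiv.symm_apply_eq]
  simpa only [this] using hf (e i) fun j => Y (e.symm j)

/-- The bounded differences inequality for independent `Ber(q)` bits, with a variance proxy that
is sharp up to a constant for small `q`. -/
lemma bounded_differences [DecidableEq ι] [Nonempty ι] (q : unitInterval) (h0 : 0 < (q : ℝ))
    (h1 : (q : ℝ) < 1 / 2) {c : ℝ} (hc : 0 < c) (f : (ι → ZMod 2) → ℝ)
    (hf : ∀ i Y, |f (Function.update Y i 1) - f (Function.update Y i 0)| ≤ c)
    (hm : 0 ≤ ∫ Y, f Y ∂(bits ι q)) :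
    (bits ι q).real {Y | f Y ≤ 0} ≤
      Real.exp (-(llr q * (∫ Y, f Y ∂(bits ι q)) ^ 2 / (4 * Fintype.card ι * c ^ 2))) := by
  have hL := llr_pos h0 h1
  set μ := ∫ Y, f Y ∂(bits ι q) with hμ
  have hn : (0 : ℝ) < Fintype.card ι := by exact_mod_cast Fintype.card_pos
  -- The minimiser over l of the exponent -l μ + (card ι) l^2 c^2 / llr q.
  set l := llr q * μ / (2 * Fintype.card ι * c ^ 2) with hl
  have hl0 : 0 ≤ l := by positivity
  have key := bounded_differences_mgf q h0 h1 (l * c) (fun Y => -l * f Y) fun i Y => by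
    rw [← mul_sub, abs_mul, abs_neg, abs_of_nonneg hl0]
    exact mul_le_mul_of_nonneg_left (hf i Y) hl0
  have markov : (bits ι q).real {Y | f Y ≤ 0} ≤ ∫ Y, Real.exp (-l * f Y) ∂(bits ι q) := by
    have := mul_meas_ge_le_integral_of_nonneg (μ := bits ι q) (f := fun Y => Real.exp (-l * f Y))
      (Filter.Eventually.of_forall fun Y => (Real.exp_pos _).le) Integrable.of_finite 1
    rw [one_mul] at this
    refine (measureReal_mono (fun Y hY => ?_)).trans this
    simp only [Set.mem_ofPred_eq] at hY ⊢
    exact Real.one_le_exp (by nlinarith)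
  refine markov.trans (key.trans (Real.exp_le_exp.2 (le_of_eq ?_)))
  rw [integral_const_mul, ← hμ, hl]
  field_simp
  ring

end Probability

/-! ### Counting subspaces -/

section Counting

variable {k m : ℕ}

noncomputable instance : Fintype (KSub k m) := Fintype.ofFinite _

lemma card_kSub_mem (B : KSub k m) : Nat.card B.1 = 2 ^ k := by
  rw [Module.natCard_eq_pow_finrank (K := ZMod 2), B.2, Nat.card_zmod]

lemma KSub.le (B : KSub k m) : k ≤ m := by
  have := Submodule.finrank_le B.1
  rwa [B.2, Module.finrank_fin_fun] at this

lemma prod_cast_sub (n : ℕ) (h : k ≤ n) :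
    ((∏ i : Fin k, (2 ^ n - 2 ^ (i : ℕ)) : ℕ) : ℝ) =
      ∏ i ∈ Finset.range k, ((2 : ℝ) ^ n - 2 ^ i) := by
  rw [Finset.prod_range, Nat.cast_prod]
  refine Finset.prod_congr rfl fun i _ => ?_
  rw [Nat.cast_sub (Nat.pow_le_pow_right (by norm_num) (i.2.le.trans h))]
  push_cast
  rfl

/-- Linearly independent families spanning `B` are bases of `B`. -/
noncomputable def spanFiberEquiv (B : KSub k m) :
    {s : {s : Fin k → Bits m // LinearIndependent (ZMod 2) s} //
      (⟨Submodule.span (ZMod 2) (Set.range s.1), by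
        rw [finrank_span_eq_card s.2, Fintype.card_fin]⟩ : KSub k m) = B} ≃
    {t : Fin k → B.1 // LinearIndependent (ZMod 2) t} where
  toFun s := ⟨fun i => ⟨s.1.1 i, by
      have := congrArg Subtype.val s.2
      dsimp only at this
      rw [← this]
      exact Submodule.subset_span ⟨i, rfl⟩⟩,
    LinearIndependent.of_comp B.1.subtype s.1.2⟩
  invFun t := ⟨⟨fun i => (t.1 i : Bits m), t.2.map' B.1.subtype (Submodule.ker_subtype _)⟩, by
    refine Subtype.ext (Submodule.eq_of_le_of_finrank_eq ?_ ?_)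
    · rw [Submodule.span_le]
      rintro _ ⟨i, rfl⟩
      exact (t.1 i).2
    · refine Eq.trans ?_ (B.2.symm)
      refine (finrank_span_eq_card (t.2.map' B.1.subtype (Submodule.ker_subtype _))).trans ?_
      rw [Fintype.card_fin]⟩
  left_inv s := rfl
  right_inv t := rfl

/-- Sort the linearly independent k-tuples by their span: every fibre is the set of ordered bases of
a k-dimensional space. The decoder's threshold is thus exactly half the number of subspaces. -/
lemma card_kSub : (Nat.card (KSub k m) : ℝ) = gaussBinom k m := by
  rcases lt_or_ge m k with h | h
  · have : IsEmpty (KSub k m) := ⟨fun B => absurd B.le (by omega)⟩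
    rw [Nat.card_of_isEmpty, gaussBinom, Finset.prod_eq_zero (Finset.mem_range.2 h) (by simp)]
    simp
  have h1 := card_linearIndependent (K := ZMod 2) (V := Bits m) (k := k) (by simpa using h)
  rw [← Nat.card_congr (Equiv.sigmaFiberEquiv
    (fun s : {s : Fin k → Bits m // LinearIndependent (ZMod 2) s} =>
      (⟨Submodule.span (ZMod 2) (Set.range s.1), by
        rw [finrank_span_eq_card s.2, Fintype.card_fin]⟩ : KSub k m))), Nat.card_sigma] at h1
  have h2 : ∀ B : KSub k m, Nat.card {t : Fin k → B.1 // LinearIndependent (ZMod 2) t} =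
      ∏ i : Fin k, (2 ^ k - 2 ^ (i : ℕ)) := by
    intro B
    have := card_linearIndependent (K := ZMod 2) (V := B.1) (k := k) B.2.ge
    rwa [B.2, ZMod.card] at this
  simp_rw [fun B : KSub k m => (Nat.card_congr (spanFiberEquiv B)).trans (h2 B)] at h1
  rw [Finset.sum_const, Finset.card_univ, ← Nat.card_eq_fintype_card, smul_eq_mul,
    Module.finrank_fin_fun, ZMod.card] at h1
  have h3 := congrArg (Nat.cast : ℕ → ℝ) h1
  rw [Nat.cast_mul, prod_cast_sub k le_rfl, prod_cast_sub m h] at h3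
  rw [gaussBinom, Finset.prod_div_distrib, ← h3, mul_div_cancel_right₀]
  refine Finset.prod_ne_zero_iff.2 fun i hi => ?_
  have : (2 : ℝ) ^ i < 2 ^ k := pow_lt_pow_right₀ (by norm_num) (Finset.mem_range.1 hi)
  linarith

lemma gaussBinom_nonneg : 0 ≤ gaussBinom k m := by
  rw [← card_kSub]; positivity

lemma gaussBinom_mono {m' : ℕ} (h' : m ≤ m') : gaussBinom k m ≤ gaussBinom k m' := by
  rcases lt_or_ge m k with h | h
  · refine le_trans (le_of_eq ?_) gaussBinom_nonneg
    rw [gaussBinom, Finset.prod_eq_zero (Finset.mem_range.2 h) (by simp)]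
  unfold gaussBinom
  have hp : ∀ i ∈ Finset.range k, (2 : ℝ) ^ i < 2 ^ k := fun i hi =>
    pow_lt_pow_right₀ (by norm_num) (Finset.mem_range.1 hi)
  have hm : (2 : ℝ) ^ k ≤ 2 ^ m := pow_le_pow_right₀ (by norm_num) h
  have hm' : (2 : ℝ) ^ m ≤ 2 ^ m' := pow_le_pow_right₀ (by norm_num) h'
  refine Finset.prod_le_prod (fun i hi => ?_) fun i hi => ?_
  · have := hp i hi
    exact div_nonneg (by linarith) (by linarith)
  · have := hp i hi
    exact div_le_div_of_nonneg_right (by linarith) (by linarith)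

lemma one_le_gaussBinom (h : k ≤ m) : 1 ≤ gaussBinom k m := by
  refine le_trans (le_of_eq ?_) (gaussBinom_mono h)
  unfold gaussBinom
  symm
  refine Finset.prod_eq_one fun i hi => div_self ?_
  have : (2 : ℝ) ^ i < 2 ^ k := pow_lt_pow_right₀ (by norm_num) (Finset.mem_range.1 hi)
  linarith

lemma exists_linearEquiv_apply_eq {v w : Bits m} (hv : v ≠ 0) (hw : w ≠ 0) :
    ∃ g : Bits m ≃ₗ[ZMod 2] Bits m, g v = w := by
  let ev := LinearEquiv.toSpanNonzeroSingleton (ZMod 2) (Bits m) v hv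
  let ew := LinearEquiv.toSpanNonzeroSingleton (ZMod 2) (Bits m) w hw
  obtain ⟨g, hg⟩ := Submodule.exists_linearEquiv_restrict_eq (ev.symm.trans ew)
  refine ⟨g, ?_⟩
  have h := hg (ev 1)
  have h1 : ((ev 1 : _) : Bits m) = v := by simp [ev]
  rw [h1] at h
  rw [← h]
  simp [ew]

/-- The general linear group is transitive on nonzero vectors and permutes the k-dimensional
subspaces. Used in both directions, this gives equality. -/
lemma card_mem_le_card_mem {v w : Bits m} (hv : v ≠ 0) (hw : w ≠ 0) :
    Nat.card {B : KSub k m // v ∈ B.1} ≤ Nat.card {B : KSub k m // w ∈ B.1} := by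
  obtain ⟨g, hg⟩ := exists_linearEquiv_apply_eq hv hw
  refine Nat.card_le_card_of_injective
    (fun B => ⟨⟨B.1.1.map (g : Bits m →ₗ[ZMod 2] Bits m), ?_⟩, ?_⟩) ?_
  · rw [LinearEquiv.finrank_map_eq, B.1.2]
  · exact hg ▸ Submodule.mem_map_of_mem B.2
  · intro B B' h
    simp only [Subtype.mk.injEq] at h
    exact Subtype.ext (Subtype.ext (Submodule.map_injective_of_injective g.injective h))

/-- Every nonzero vector lies in a fraction at most `2^k / 2^m` of the `k`-dimensional
subspaces. -/
lemma card_mem_mul_le {v : Bits m} (hv : v ≠ 0) :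
    Nat.card {B : KSub k m // v ∈ B.1} * 2 ^ m ≤ Nat.card (KSub k m) * 2 ^ k := by
  classical
  set a := Nat.card {B : KSub k m // v ∈ B.1} with ha
  have hall : ∀ w : Bits m, w ≠ 0 → Fintype.card {B : KSub k m // w ∈ B.1} = a := fun w hw => by
    rw [ha, ← Nat.card_eq_fintype_card]
    exact le_antisymm (card_mem_le_card_mem hw hv) (card_mem_le_card_mem hv hw)
  have hdouble : ∑ w : Bits m, Fintype.card {B : KSub k m // w ∈ B.1} =
      ∑ B : KSub k m, Fintype.card B.1 := by
    simp_rw [Fintype.card_subtype, Finset.card_filter]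
    rw [Finset.sum_comm]
  have hB : ∀ B : KSub k m, Fintype.card B.1 = 2 ^ k := fun B => by
    rw [← Nat.card_eq_fintype_card]; exact card_kSub_mem B
  have h0 : Fintype.card {B : KSub k m // (0 : Bits m) ∈ B.1} = Nat.card (KSub k m) := by
    simp [Nat.card_eq_fintype_card]
  rw [← Finset.add_sum_erase _ _ (Finset.mem_univ (0 : Bits m)), h0,
    Finset.sum_congr rfl fun w hw => hall w (Finset.ne_of_mem_erase hw), Finset.sum_const,
    Finset.sum_congr rfl fun B _ => hB B, Finset.sum_const, Finset.card_univ,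
    Finset.card_erase_of_mem (Finset.mem_univ _), Finset.card_univ, smul_eq_mul, smul_eq_mul,
    ← Nat.card_eq_fintype_card (α := KSub k m)] at hdouble
  have hc : Fintype.card (Bits m) = 2 ^ m := by simp
  rw [hc] at hdouble
  -- With n the number of subspaces, counting incidences gives a (2^m - 1) = n (2^k - 1); adding a ≤
  -- n yields the cleaner bound.
  have hle : a ≤ Nat.card (KSub k m) := Finite.card_subtype_le _
  obtain ⟨t, ht⟩ : ∃ t, 2 ^ m = t + 1 := ⟨2 ^ m - 1, by have := Nat.one_le_two_pow (n := m); omega⟩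
  rw [ht] at hdouble ⊢
  simp only [Nat.add_sub_cancel] at hdouble
  nlinarith

end Counting

/-! ### Projections -/

instance (m : ℕ) (q : unitInterval) : IsProbabilityMeasure (bscLaw m q) :=
  inferInstanceAs (IsProbabilityMeasure (bits (Bits m) q))

section Projection

open Classical

variable {k m : ℕ} (idx : CosetIndexing k)

/-- The points of the coset of `B` with index `z`. -/
noncomputable def coset (B : KSub k m) (z : Bits (m - k)) : Finset (Bits m) :=
  {y | idx m B (B.1.mkQ y) = z}

lemma mem_coset {B : KSub k m} {z : Bits (m - k)} {y : Bits m} :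
    y ∈ coset idx B z ↔ idx m B (B.1.mkQ y) = z :=
  Finset.mem_filter.trans (by simp)

lemma mem_coset_mk {B : KSub k m} {x y : Bits m} :
    y ∈ coset idx B (idx m B (B.1.mkQ x)) ↔ y - x ∈ B.1 := by
  rw [mem_coset, (idx m B).injective.eq_iff, Submodule.mkQ_apply, Submodule.mkQ_apply,
    Submodule.Quotient.eq]

lemma card_coset (B : KSub k m) (z : Bits (m - k)) : (coset idx B z).card = 2 ^ k := by
  obtain ⟨w, rfl⟩ := (idx m B).surjective z
  obtain ⟨x, rfl⟩ := B.1.mkQ_surjective w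
  rw [← card_kSub_mem B, Nat.card_eq_fintype_card, Fintype.card_subtype]
  refine Finset.card_nbij' (fun y => y - x) (fun y => y + x) ?_ ?_ ?_ ?_
  · intro y hy
    simpa using (mem_coset_mk idx).1 hy
  · intro y hy
    refine (mem_coset_mk idx).2 ?_
    simpa using hy
  · intro y _; simp
  · intro y _; simp

lemma proj_apply (B : KSub k m) (Y : Word m) (z : Bits (m - k)) :
    proj idx B Y z = ∑ y ∈ coset idx B z, Y y := rfl

lemma sgn_proj (B : KSub k m) (Y : Word m) (z : Bits (m - k)) :
    sgn (proj idx B Y z) = ∏ y ∈ coset idx B z, sgn (Y y) := by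
  rw [proj_apply, sgn_sum]

lemma proj_zero (B : KSub k m) : proj idx B (0 : Word m) = 0 := by
  ext z; simp [proj_apply]

/-- Projections of independent bits are independent bits. -/
lemma map_proj (B : KSub k m) (q q' : unitInterval)
    (h : 1 - 2 * (q' : ℝ) = (1 - 2 * (q : ℝ)) ^ 2 ^ k) :
    (bscLaw m q).map (proj idx B) = bscLaw (m - k) q' := by
  have : IsProbabilityMeasure ((bits (Bits m) q).map (proj idx B)) :=
    Measure.isProbabilityMeasure_map (measurable_of_finite _).aemeasurable
  refine ext_of_integral_prod_sgn ((bits (Bits m) q).map (proj idx B)) (bits _ q') fun T => ?_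
  rw [integral_map (measurable_of_finite _).aemeasurable
    (measurable_of_finite _).aestronglyMeasurable, integral_prod_sgn, h, ← pow_mul]
  simp_rw [sgn_proj]
  -- Disjointness turns the character of T on the projection into the character of a union of
  -- cosets, of size 2^k * T.card.
  have hd : (T : Set (Bits (m - k))).PairwiseDisjoint (coset idx B) := by
    intro z _ z' _ hz
    rw [Function.onFun, Finset.disjoint_left]
    intro y hy hy'
    exact hz (((mem_coset idx).1 hy).symm.trans ((mem_coset idx).1 hy'))
  simp_rw [← Finset.prod_biUnion hd]
  rw [integral_prod_sgn, Finset.card_biUnion hd, Finset.sum_congr rfl fun z _ => card_coset idx B z,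
    Finset.sum_const, smul_eq_mul, mul_comm T.card]

/-! ### Aggregation when all estimates vanish -/

/-- The average over all `B` of the sign of the parity of the other points of the coset of `x`. -/
noncomputable def vote (x : Bits m) (Y : Word m) : ℝ :=
  (∑ B : KSub k m, ∏ y ∈ (coset idx B (idx m B (B.1.mkQ x))).erase x, sgn (Y y)) / gaussBinom k m

lemma self_mem_coset (B : KSub k m) (x : Bits m) : x ∈ coset idx B (idx m B (B.1.mkQ x)) :=
  (mem_coset_mk idx).2 (by simp)

/-- The sign of the parity over x + B factors as sgn (Y x) times the parity of the other points, so
the dependence on Y x comes out of the sum over B. -/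
lemma disagreements_zero (hkm : k ≤ m) (x : Bits m) (Y : Word m) :
    (disagreements idx Y (fun _ => 0) x : ℝ) =
      gaussBinom k m / 2 * (1 - sgn (Y x) * vote idx x Y) := by
  have hn := one_le_gaussBinom hkm
  have e : ∀ B : KSub k m, (if proj idx B Y (idx m B (B.1.mkQ x)) ≠ 0 then (1 : ℝ) else 0) =
      1 / 2 * (1 - sgn (Y x) *
        ∏ y ∈ (coset idx B (idx m B (B.1.mkQ x))).erase x, sgn (Y y)) := by
    intro B
    rw [Finset.mul_prod_erase _ (fun y => sgn (Y y)) (self_mem_coset idx B x), ← sgn_proj]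
    rcases zmod_two_cases (proj idx B Y (idx m B (B.1.mkQ x))) with h | h <;> rw [h] <;> norm_num
  rw [disagreements, Nat.card_eq_fintype_card, Fintype.card_subtype, Finset.card_filter,
    Nat.cast_sum]
  simp only [Pi.zero_apply, Nat.cast_ite, Nat.cast_one, Nat.cast_zero]
  rw [Finset.sum_congr rfl fun B _ => e B, ← Finset.mul_sum, Finset.sum_sub_distrib,
    ← Finset.mul_sum, Finset.sum_const, Finset.card_univ, ← Nat.card_eq_fintype_card,
    nsmul_eq_mul, card_kSub, mul_one, vote]
  field_simp

lemma aggregate_zero_apply (hkm : k ≤ m) (x : Bits m) (Y : Word m) (h : 0 < vote idx x Y) :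
    aggregate idx Y (fun _ => 0) x = 0 := by
  have hn := one_le_gaussBinom hkm
  rw [aggregate, disagreements_zero idx hkm]
  have hp : 0 < gaussBinom k m / 2 * vote idx x Y := by positivity
  rcases zmod_two_cases (Y x) with h0 | h0 <;> rw [h0]
  · rw [sgn_zero, if_neg (by nlinarith), add_zero]
  · rw [sgn_one, if_pos (by nlinarith)]
    decide

lemma integral_vote (hkm : k ≤ m) (x : Bits m) (q : unitInterval) :
    ∫ Y, vote idx x Y ∂(bits (Bits m) q) = (1 - 2 * (q : ℝ)) ^ (2 ^ k - 1) := by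
  have hn := one_le_gaussBinom hkm
  simp_rw [vote]
  rw [integral_div, integral_finsetSum _ fun T _ => Integrable.of_finite]
  simp_rw [integral_prod_sgn, Finset.card_erase_of_mem (self_mem_coset idx _ x), card_coset]
  rw [Finset.sum_const, Finset.card_univ, ← Nat.card_eq_fintype_card, nsmul_eq_mul, card_kSub]
  field_simp

lemma abs_prod_sgn (T : Finset (Bits m)) (Y : Word m) : |∏ y ∈ T, sgn (Y y)| = 1 := by
  rw [Finset.abs_prod]
  exact Finset.prod_eq_one fun y _ => abs_sgn _

/-- Bit i enters only the terms with i ≠ x and i - x in B, each of which moves by at most 2;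
`card_mem_mul_le` bounds their share. -/
lemma vote_bounded_differences (hkm : k ≤ m) (x i : Bits m) (Y : Word m) :
    |vote idx x (Function.update Y i 1) - vote idx x (Function.update Y i 0)| ≤
      2 * 2 ^ k / 2 ^ m := by
  have hn := one_le_gaussBinom hkm
  rw [vote, vote, ← sub_div, ← Finset.sum_sub_distrib, abs_div,
    abs_of_nonneg (gaussBinom_nonneg (k := k) (m := m)), div_le_iff₀ (by linarith)]
  refine (Finset.abs_sum_le_sum_abs _ _).trans ?_
  have hB : ∀ B : KSub k m,
      |∏ y ∈ (coset idx B (idx m B (B.1.mkQ x))).erase x, sgn (Function.update Y i 1 y) -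
        ∏ y ∈ (coset idx B (idx m B (B.1.mkQ x))).erase x, sgn (Function.update Y i 0 y)| ≤
      2 * if (i ≠ x ∧ i - x ∈ B.1) then 1 else 0 := by
    intro B
    split_ifs with hi
    · refine (abs_sub _ _).trans ?_
      rw [abs_prod_sgn, abs_prod_sgn]; norm_num
    · have : i ∉ (coset idx B (idx m B (B.1.mkQ x))).erase x := by
        rwa [Finset.mem_erase, mem_coset_mk]
      rw [mul_zero, abs_nonpos_iff, sub_eq_zero]
      refine Finset.prod_congr rfl fun y hy => ?_
      have : y ≠ i := fun h => this (h ▸ hy)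
      rw [Function.update_of_ne this, Function.update_of_ne this]
  refine (Finset.sum_le_sum fun B _ => hB B).trans ?_
  rw [← Finset.mul_sum]
  by_cases hi : i = x
  · simp only [hi, ne_eq, not_true_eq_false, false_and, if_false, Finset.sum_const_zero, mul_zero]
    positivity
  · have h1 := card_mem_mul_le (k := k) (v := i - x) (sub_ne_zero.2 hi)
    have h2 : ∑ B : KSub k m, (if (i ≠ x ∧ i - x ∈ B.1) then (1 : ℝ) else 0) =
        Nat.card {B : KSub k m // i - x ∈ B.1} := by
      simp [hi, Nat.card_eq_fintype_card, Fintype.card_subtype]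
    rw [h2]
    have h3 := (Nat.cast_le (α := ℝ)).2 h1
    push_cast at h3
    rw [card_kSub] at h3
    rw [div_mul_eq_mul_div, le_div_iff₀ (by positivity)]
    linarith

/-- Bounded differences with mean at least 2ε and c = 2 * 2^k / 2^m; these two values produce the
factor 2^(-2k-2). -/
lemma vote_nonpos_prob (hkm : k ≤ m) (x : Bits m) (q : unitInterval) (h0 : 0 < (q : ℝ))
    (h1 : (q : ℝ) < 1 / 2) {ε : ℝ} (hε0 : 0 ≤ ε) (hε : 2 * ε ≤ (1 - 2 * (q : ℝ)) ^ (2 ^ k - 1)) :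
    (bscLaw m q).real {Y | vote idx x Y ≤ 0} ≤
      Real.exp (-(llr q * 2 ^ (-2 * (k : ℤ) - 2) * 2 ^ m * ε ^ 2)) := by
  have hL := llr_pos h0 h1
  have := bounded_differences (ι := Bits m) q h0 h1 (c := 2 * 2 ^ k / 2 ^ m) (by positivity)
    (vote idx x) (vote_bounded_differences idx hkm x)
    (by rw [integral_vote idx hkm]; linarith)
  refine this.trans (Real.exp_le_exp.2 (neg_le_neg ?_))
  rw [integral_vote idx hkm]
  have hc : (Fintype.card (Bits m) : ℝ) = 2 ^ m := by simp
  have hz : (2 : ℝ) ^ (-2 * (k : ℤ) - 2) = 1 / (4 * 2 ^ k * 2 ^ k) := by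
    rw [show -2 * (k : ℤ) - 2 = -((2 + k + k : ℕ) : ℤ) by push_cast; ring, zpow_neg, zpow_natCast,
      pow_add, pow_add]
    norm_num
  have hsq : (2 * ε) ^ 2 ≤ ((1 - 2 * (q : ℝ)) ^ (2 ^ k - 1)) ^ 2 := by gcongr
  rw [hc, hz]
  calc llr q * (1 / (4 * 2 ^ k * 2 ^ k)) * 2 ^ m * ε ^ 2
      = llr q * (2 * ε) ^ 2 / (4 * 2 ^ m * (2 * 2 ^ k / 2 ^ m) ^ 2) := by field_simp
    _ ≤ _ := by gcongr

end Projection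

/-! ### First-order codes -/

section FirstOrder

variable {m : ℕ}

/-- The affine function `z ↦ b + ∑ aᵢ zᵢ` as a word. -/
def affineWord (b : ZMod 2) (a : Bits m) : Word m := fun z => b + ∑ i, a i * z i

lemma exists_affineWord {c : Word m} (hc : c ∈ reedMuller m 1) : ∃ b a, c = affineWord b a := by
  classical
  obtain ⟨f, hf, rfl⟩ := hc
  refine ⟨f.coeff 0, fun i => f.coeff (Finsupp.single i 1), funext fun z => ?_⟩
  have hinj : Function.Injective fun i : Fin m => Finsupp.single i (1 : ℕ) :=
    Finsupp.single_left_injective one_ne_zero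
  have hsub : f.support ⊆ insert 0 (Finset.univ.image fun i : Fin m => Finsupp.single i 1) := by
    intro d hd
    have h1 : d.degree ≤ 1 := (MvPolynomial.le_totalDegree hd).trans hf
    rw [Finset.mem_insert, Finset.mem_image]
    rcases Nat.le_one_iff_eq_zero_or_eq_one.1 h1 with h | h
    · exact Or.inl ((Finsupp.degree_eq_zero_iff d).1 h)
    · obtain ⟨i, rfl⟩ := (Finsupp.sum_eq_one_iff d).1 h
      exact Or.inr ⟨i, Finset.mem_univ _, rfl⟩
  rw [MvPolynomial.eval_eq, Finset.sum_subset hsub fun d _ hd => by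
    rw [MvPolynomial.notMem_support_iff.1 hd, zero_mul], Finset.sum_insert, Finset.sum_image
      fun i _ j _ h => hinj h]
  · simp [affineWord, Finsupp.single_apply, pow_ite]
  · simp

lemma zero_mem_reedMuller (r : ℕ) : (0 : Word m) ∈ reedMuller m r :=
  ⟨0, by simp, by ext; simp⟩

/-- Nonzero affine words have weight at least half of their length. -/
lemma two_pow_le_two_mul_card_support (b : ZMod 2) (a : Bits m) (h : affineWord b a ≠ 0) :
    2 ^ m ≤ 2 * (Finset.univ.filter fun z => affineWord b a z ≠ 0).card := by
  classical
  have hcard : (Finset.univ.filter fun z => affineWord b a z ≠ 0).card +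
      (Finset.univ.filter fun z => ¬ affineWord b a z ≠ 0).card = 2 ^ m := by
    rw [Finset.card_filter_add_card_filter_not]; simp
  suffices (Finset.univ.filter fun z => ¬ affineWord b a z ≠ 0).card ≤
      (Finset.univ.filter fun z => affineWord b a z ≠ 0).card by omega
  by_cases ha : a = 0
  · have hb : b ≠ 0 := by
      rintro rfl
      exact h (by ext z; simp [affineWord, ha])
    rw [Finset.card_eq_zero.2]
    · exact Nat.zero_le _
    · refine Finset.filter_eq_empty_iff.2 fun z _ => ?_
      simpa [affineWord, ha] using hb
  · obtain ⟨i, hi⟩ := Function.ne_iff.1 ha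
    -- Translating along a coordinate with a i ≠ 0 flips the value, so zeros inject into nonzeros.
    refine Finset.card_le_card_of_injOn (fun z => z + Pi.single i 1) ?_ ?_
    · intro z hz
      simp only [Finset.coe_filter, Finset.mem_univ, true_and, not_not, Set.mem_ofPred_eq] at hz ⊢
      have : affineWord b a (z + Pi.single i 1) = affineWord b a z + a i := by
        simp [affineWord, mul_add, Finset.sum_add_distrib, Pi.single_apply, add_assoc]
      rw [this, hz, zero_add]
      exact hi
    · intro z _ z' _ hz
      exact add_right_cancel hz

/-- The Chernoff rate for the majority of `Ber(q)` bits. -/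
noncomputable def chernoff (q : ℝ) : ℝ := Real.sqrt (1 - (1 - 2 * q) ^ 2)

/-- The tilt llr q / 2 is optimal: it makes both summands equal to sqrt (q (1 - q)). -/
lemma chernoff_eq {q : ℝ} (h0 : 0 < q) (h1 : q < 1 / 2) :
    q * Real.exp (llr q / 2) + (1 - q) * Real.exp (-(llr q / 2)) = chernoff q := by
  symm
  have hp : 0 < 1 - q := by linarith
  refine (Real.sqrt_eq_iff_mul_self_eq_of_pos (by positivity)).2 ?_
  have e1 : Real.exp (llr q / 2) * Real.exp (llr q / 2) = Real.exp (llr q) := by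
    rw [← Real.exp_add]; ring_nf
  have e2 : Real.exp (llr q / 2) * Real.exp (-(llr q / 2)) = 1 := by
    rw [← Real.exp_add]; simp
  have e3 := mul_exp_llr h0 h1
  set x := Real.exp (llr q / 2)
  set y := Real.exp (-(llr q / 2))
  have e4 : q * x ^ 2 = 1 - q := by rw [sq, e1, e3]
  have e5 : (1 - q) * y ^ 2 = q := by
    rw [← e4]
    linear_combination q * (x * y + 1) * e2
  linear_combination q * e4 + (1 - q) * e5 + 2 * q * (1 - q) * e2

lemma chernoff_le_one (q : ℝ) : chernoff q ≤ 1 := by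
  unfold chernoff
  rw [Real.sqrt_le_one]
  nlinarith [sq_nonneg (1 - 2 * q)]

lemma majority_prob {ι : Type*} [Fintype ι] (q : unitInterval) (h0 : 0 < (q : ℝ))
    (h1 : (q : ℝ) < 1 / 2) (S : Finset ι) :
    (bits ι q).real {Y | ∑ i ∈ S, sgn (Y i) ≤ 0} ≤ chernoff q ^ S.card := by
  have hL := llr_pos h0 h1
  have h := integral_bits_prod_finset q S fun a => Real.exp (-(llr q / 2 * sgn a))
  simp only [sgn_one, sgn_zero, mul_one, mul_neg, neg_neg] at h
  rw [chernoff_eq h0 h1] at h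
  rw [← h]
  have := mul_meas_ge_le_integral_of_nonneg (μ := bits ι q)
    (f := fun Y => ∏ i ∈ S, Real.exp (-(llr q / 2 * sgn (Y i))))
    (Filter.Eventually.of_forall fun Y => Finset.prod_nonneg fun i _ => (Real.exp_pos _).le)
    Integrable.of_finite 1
  rw [one_mul] at this
  refine (measureReal_mono fun Y hY => ?_).trans this
  simp only [Set.mem_ofPred_eq] at hY ⊢
  rw [← Real.exp_sum, Finset.sum_neg_distrib, ← Finset.mul_sum]
  exact Real.one_le_exp (by nlinarith)

variable {dec : ∀ m : ℕ, Word m → Word m}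

/-- The output is at least as close to Y as the zero codeword, and the two distances differ only on
the support of the output, by exactly this sum. -/
lemma IsMLDecoder.sum_sgn_nonpos (hdec : IsMLDecoder dec) (Y : Word m) :
    ∑ z with dec m Y z ≠ 0, sgn (Y z) ≤ 0 := by
  have h := (hdec m Y).2 0 (zero_mem_reedMuller 1)
  rw [hammingDist, hammingDist, Finset.card_filter, Finset.card_filter] at h
  have h' := (Nat.cast_le (α := ℝ)).2 h
  push_cast at h'
  rw [← sub_nonpos, ← Finset.sum_sub_distrib] at h'
  refine le_trans (le_of_eq ?_) h'
  rw [Finset.sum_filter]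
  refine Finset.sum_congr rfl fun z _ => ?_
  rcases zmod_two_cases (Y z) with h1 | h1 <;> rcases zmod_two_cases (dec m Y z) with h2 | h2 <;>
    simp [h1, h2]

/-- Union bound over the 2^(m+1) affine functions; each nonzero one has a support of size at least
2^(m-1), on which the majority must be wrong. -/
lemma IsMLDecoder.fail_prob (hdec : IsMLDecoder dec) (hm : 1 ≤ m) (q : unitInterval)
    (h0 : 0 < (q : ℝ)) (h1 : (q : ℝ) < 1 / 2) :
    (bscLaw m q).real {Y | dec m Y ≠ 0} ≤ 2 ^ (m + 1) * chernoff q ^ 2 ^ (m - 1) := by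
  have hsub : {Y | dec m Y ≠ 0} ⊆ ⋃ x : ZMod 2 × Bits m, {Y | affineWord x.1 x.2 ≠ 0 ∧
      ∑ z with affineWord x.1 x.2 z ≠ 0, sgn (Y z) ≤ 0} := by
    intro Y hY
    obtain ⟨b, a, hba⟩ := exists_affineWord (hdec m Y).1
    refine Set.mem_iUnion.2 ⟨(b, a), ?_⟩
    have := hdec.sum_sgn_nonpos Y
    rw [Set.mem_ofPred_eq] at hY ⊢
    rw [hba] at this hY
    exact ⟨hY, this⟩
  refine (measureReal_mono hsub).trans ((measureReal_iUnion_fintype_le _).trans ?_)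
  have hx : ∀ x : ZMod 2 × Bits m, (bscLaw m q).real {Y | affineWord x.1 x.2 ≠ 0 ∧
      ∑ z with affineWord x.1 x.2 z ≠ 0, sgn (Y z) ≤ 0} ≤ chernoff q ^ 2 ^ (m - 1) := by
    intro x
    by_cases hx : affineWord x.1 x.2 = 0
    · simp only [hx, ne_eq, not_true_eq_false, false_and]
      have : {Y : Word m | False} = ∅ := by ext; simp
      rw [this, measureReal_empty]
      exact pow_nonneg (Real.sqrt_nonneg _) _
    · have hw := two_pow_le_two_mul_card_support x.1 x.2 hx
      obtain ⟨t, rfl⟩ : ∃ t, m = t + 1 := ⟨m - 1, by omega⟩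
      refine (measureReal_mono fun Y hY => hY.2).trans ((majority_prob q h0 h1 _).trans ?_)
      refine pow_le_pow_of_le_one (Real.sqrt_nonneg _) (chernoff_le_one _) ?_
      rw [pow_succ] at hw
      simp only [Nat.add_sub_cancel]
      omega
  refine (Finset.sum_le_sum fun x _ => hx x).trans (le_of_eq ?_)
  rw [Finset.sum_const, Finset.card_univ, nsmul_eq_mul]
  congr 1
  simp [pow_succ, mul_comm]

lemma IsMLDecoder.map_zero (hdec : IsMLDecoder dec) : dec m 0 = 0 := by
  have h := (hdec m 0).2 0 (zero_mem_reedMuller 1)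
  rw [hammingDist_self, Nat.le_zero, hammingDist_eq_zero] at h
  exact h.symm

end FirstOrder

/-! ### Crossover probabilities -/

section Crossover

lemma one_sub_two_mul_crossover (p : ℝ) (i : ℕ) :
    1 - 2 * crossover p i = (1 - 2 * p) ^ 2 ^ i := by
  unfold crossover; ring

lemma crossover_crossover (p : ℝ) (i j : ℕ) :
    crossover (crossover p i) j = crossover p (i + j) := by
  have h := one_sub_two_mul_crossover (crossover p i) j
  rw [one_sub_two_mul_crossover p i, ← pow_mul, ← pow_add, ← one_sub_two_mul_crossover p] at h
  linarith

lemma crossover_zero (p : ℝ) : crossover p 0 = p := by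
  unfold crossover; ring

lemma crossover_pos {p : ℝ} (h0 : 0 < p) (h1 : p < 1 / 2) (i : ℕ) : 0 < crossover p i := by
  have h := one_sub_two_mul_crossover p i
  have : (1 - 2 * p) ^ 2 ^ i < 1 := pow_lt_one₀ (by linarith) (by linarith) (by positivity)
  linarith

lemma crossover_lt_half {p : ℝ} (h1 : p < 1 / 2) (i : ℕ) : crossover p i < 1 / 2 := by
  have h := one_sub_two_mul_crossover p i
  have : 0 < (1 - 2 * p) ^ 2 ^ i := pow_pos (by linarith) _
  linarith

lemma crossover_mono {p : ℝ} (h0 : 0 < p) (h1 : p < 1 / 2) {i j : ℕ} (hij : i ≤ j) :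
    crossover p i ≤ crossover p j := by
  have h := one_sub_two_mul_crossover p i
  have h' := one_sub_two_mul_crossover p j
  have : (1 - 2 * p) ^ 2 ^ j ≤ (1 - 2 * p) ^ 2 ^ i :=
    pow_le_pow_of_le_one (by linarith) (by linarith) (Nat.pow_le_pow_right (by norm_num) hij)
  linarith

/-- The crossover probability `p^{(i)}` as an element of the unit interval. -/
noncomputable def crossoverI (q : unitInterval) (i : ℕ) : unitInterval :=
  ⟨crossover q i, by
    have h := one_sub_two_mul_crossover q i
    have h0 := q.2.1
    have h1 := q.2.2
    have : |(1 - 2 * (q : ℝ)) ^ 2 ^ i| ≤ 1 := by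
      rw [abs_pow]
      exact pow_le_one₀ (abs_nonneg _) (abs_le.2 ⟨by linarith, by linarith⟩)
    rw [abs_le] at this
    constructor <;> linarith⟩

lemma coe_crossoverI (q : unitInterval) (i : ℕ) : (crossoverI q i : ℝ) = crossover q i := rfl

/-- The exponent of the majority vote over cosets of size `2^k` beats the log-likelihood ratio of
the original channel. -/
lemma one_sub_sq_le {q : ℝ} (h0 : 0 < q) (h1 : q < 1 / 2) {k : ℕ} (hk : 1 ≤ k) :
    1 - ((1 - 2 * q) ^ 2 ^ k) ^ 2 ≤
      Real.exp (-(llr q * ((1 - 2 * q) ^ 2 ^ k) ^ 2 / 2 ^ (k + 1))) := by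
  have hL := llr_pos h0 h1
  set u2 := ((1 - 2 * q) ^ 2 ^ k) ^ 2 with hu
  have hu0 : 0 ≤ u2 := sq_nonneg _
  have hu1 : u2 ≤ 1 := pow_le_one₀ (pow_nonneg (by linarith) _)
    (pow_le_one₀ (by linarith) (by linarith))
  -- For moderate llr q, 1 - u2 ≤ exp (-u2) is enough. For large llr q, q is exponentially small,
  -- and Bernoulli's inequality gives 1 - u2 ≤ 2^(k+2) q.
  rcases le_or_gt (llr q) (2 ^ (k + 1)) with h | h
  · refine le_trans ?_ (Real.exp_le_exp.2 (neg_le_neg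
      ((div_le_iff₀ (by positivity)).2 (?_ : _ ≤ u2 * 2 ^ (k + 1)))))
    · linarith [Real.add_one_le_exp (-u2)]
    · rw [mul_comm]; gcongr
  · have hb : 1 + ((2 ^ k * 2 : ℕ) : ℝ) * (-2 * q) ≤ u2 := by
      rw [hu, ← pow_mul]
      have := one_add_mul_le_pow (a := -2 * q) (by linarith) (2 ^ k * 2)
      rwa [show 1 + -2 * q = 1 - 2 * q by ring] at this
    push_cast at hb
    have hq : q ≤ Real.exp (-llr q) := by
      have e := mul_exp_llr h0 h1
      have e2 : Real.exp (llr q) * Real.exp (-llr q) = 1 := by rw [← Real.exp_add]; simp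
      calc q = (q * Real.exp (llr q)) * Real.exp (-llr q) := by rw [mul_assoc, e2, mul_one]
        _ ≤ 1 * Real.exp (-llr q) := by rw [e]; gcongr; linarith
        _ = _ := one_mul _
    have h2e : (2 : ℝ) ^ (k + 2) ≤ Real.exp (k + 2) := by
      have : (2 : ℝ) ≤ Real.exp 1 := by linarith [Real.add_one_le_exp (1 : ℝ)]
      calc (2 : ℝ) ^ (k + 2) ≤ Real.exp 1 ^ (k + 2) := by gcongr
        _ = _ := by rw [← Real.exp_nat_mul]; push_cast; ring_nf
    have hnat : ((k + 3 : ℕ) : ℝ) ≤ 2 ^ (k + 1) := by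
      have : k + 3 ≤ 2 ^ (k + 1) := by
        clear * - hk
        induction k, hk using Nat.le_induction with
        | base => norm_num
        | succ n hn ih => rw [pow_succ]; omega
      exact_mod_cast this
    push_cast at hnat
    calc 1 - u2 ≤ 2 ^ (k + 2) * q := by rw [pow_add]; linarith
      _ ≤ Real.exp (k + 2) * Real.exp (-llr q) := by gcongr
      _ = Real.exp (k + 2 - llr q) := by rw [← Real.exp_add]; ring_nf
      _ ≤ _ := by
        refine Real.exp_le_exp.2 ?_
        have : llr q * u2 / 2 ^ (k + 1) ≤ llr q - (k + 2) := by
          rw [div_le_iff₀ (by positivity)]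
          have : llr q * u2 ≤ llr q := by nlinarith
          nlinarith
        linarith

/-- Here 2^(n+1) is the length of a leaf and 2^(n+1+k) that of its parent, whose crossover
probability is q. The square on the right is what later allows the leaves to be absorbed. -/
lemma chernoff_crossover_pow_le {q : ℝ} (h0 : 0 < q) (h1 : q < 1 / 2) {k : ℕ} (hk : 1 ≤ k) (n : ℕ)
    {ε : ℝ} (hε0 : 0 ≤ ε) (hε : 2 * ε ≤ (1 - 2 * q) ^ 2 ^ k) :
    chernoff (crossover q k) ^ 2 ^ n ≤
      Real.exp (-(llr q * 2 ^ (-2 * (k : ℤ) - 2) * 2 ^ (n + 1 + k) * ε ^ 2)) ^ 2 := by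
  have hL := llr_pos h0 h1
  have hz : (2 : ℝ) ^ (-2 * (k : ℤ) - 2) = 1 / (4 * 2 ^ k * 2 ^ k) := by
    rw [show -2 * (k : ℤ) - 2 = -((2 + k + k : ℕ) : ℤ) by push_cast; ring, zpow_neg, zpow_natCast,
      pow_add, pow_add]
    norm_num
  have hsq : (2 * ε) ^ 2 ≤ ((1 - 2 * q) ^ 2 ^ k) ^ 2 := by gcongr
  have hc : chernoff (crossover q k) ≤ Real.exp (-(llr q * ε ^ 2 / 2 ^ k)) := by
    unfold chernoff
    rw [one_sub_two_mul_crossover]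
    refine Real.sqrt_le_iff.2 ⟨(Real.exp_pos _).le, (one_sub_sq_le h0 h1 hk).trans ?_⟩
    rw [← Real.exp_nat_mul]
    refine Real.exp_le_exp.2 ?_
    push_cast
    rw [mul_neg, neg_le_neg_iff]
    calc 2 * (llr q * ε ^ 2 / 2 ^ k) = llr q * (2 * ε) ^ 2 / 2 ^ (k + 1) := by
          rw [pow_succ]; field_simp; ring
      _ ≤ _ := by gcongr
  refine (pow_le_pow_left₀ (Real.sqrt_nonneg _) hc _).trans (le_of_eq ?_)
  rw [← Real.exp_nat_mul, ← Real.exp_nat_mul, hz, pow_add, pow_add]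
  congr 1
  push_cast
  field_simp
  norm_num

end Crossover

/-! ### The decoder -/

section Decoder

variable {k : ℕ} (idx : CosetIndexing k) {dec : ∀ m : ℕ, Word m → Word m} {Miter : ℕ}

lemma iterateUntilFixed_eq_zero {m : ℕ} {step : Word m → Word m} (h0 : step 0 = 0) {t : ℕ}
    {Y : Word m} (ht : 1 ≤ t) (hY : step Y = 0) : iterateUntilFixed step t Y = 0 := by
  obtain ⟨t, rfl⟩ : ∃ u, t = u + 1 := ⟨t - 1, by omega⟩
  rw [iterateUntilFixed, hY]
  split_ifs with h
  · exact h
  · cases t with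
    | zero => rfl
    | succ t => rw [iterateUntilFixed, h0, if_pos rfl]

lemma aggregate_zero {m : ℕ} : aggregate idx (0 : Word m) (fun _ => 0) = 0 := by
  ext x
  have : disagreements idx (0 : Word m) (fun _ => 0) x = 0 := by
    simp [disagreements, proj_zero]
  rw [aggregate, this, if_neg]
  · simp
  · have := gaussBinom_nonneg (k := k) (m := m)
    push_cast
    linarith

lemma decode_zero (hdec : IsMLDecoder dec) (hM : 1 ≤ Miter) (s : ℕ) :
    ∀ m, decode idx dec Miter s m 0 = 0 := by
  induction s with
  | zero => exact fun m => hdec.map_zero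
  | succ s ih =>
    intro m
    have : aggregate idx (0 : Word m)
        (fun B => decode idx dec Miter s (m - k) (proj idx B 0)) = 0 := by
      simp_rw [proj_zero, ih]
      exact aggregate_zero idx
    exact iterateUntilFixed_eq_zero this hM this

/-- The first aggregation already reaches zero, and later iterations stay there, so the iteration
limit plays no further role. -/
lemma decode_succ_eq_zero (hdec : IsMLDecoder dec) (hM : 1 ≤ Miter) {s m : ℕ} (hkm : k ≤ m)
    {Y : Word m} (hB : ∀ B : KSub k m, decode idx dec Miter s (m - k) (proj idx B Y) = 0)
    (hv : ∀ x, 0 < vote idx x Y) : decode idx dec Miter (s + 1) m Y = 0 := by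
  refine iterateUntilFixed_eq_zero ?_ hM ?_
  · simp_rw [proj_zero, decode_zero idx hdec hM]
    exact aggregate_zero idx
  · simp_rw [hB]
    exact funext fun x => aggregate_zero_apply idx hkm x Y (hv x)

/-- Induction on the aggregation levels: a failure needs a failing child (at most n of them) or a
nonpositive vote (2^m positions). The numbers n, e and F bound the branching, a single vote failure
and a leaf failure uniformly over the subtree. -/
lemma decode_fail_prob (hdec : IsMLDecoder dec) (hM : 1 ≤ Miter) {ε e F n : ℝ} (hε0 : 0 ≤ ε)
    (he : 0 ≤ e) (s : ℕ) : ∀ (m : ℕ) (q : unitInterval), 0 < (q : ℝ) → (q : ℝ) < 1 / 2 →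
    k * s + 1 ≤ m → gaussBinom k m ≤ n → 2 * ε ≤ (1 - 2 * (q : ℝ)) ^ 2 ^ (k * s) →
    (∀ i < s, Real.exp (-(llr (crossover q (k * i)) * 2 ^ (-2 * (k : ℤ) - 2) *
      2 ^ (m - k * i) * ε ^ 2)) ≤ e) →
    2 ^ (m - k * s + 1) * chernoff (crossover q (k * s)) ^ 2 ^ (m - k * s - 1) ≤ F →
    (bscLaw m q).real {Y | decode idx dec Miter s m Y ≠ 0} ≤
      n ^ s * F + s * n ^ (s - 1) * 2 ^ m * e := by
  induction s with
  | zero =>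
    intro m q h0 h1 hm _ _ _ hF
    simp only [mul_zero, Nat.sub_zero, crossover_zero] at hF
    refine (hdec.fail_prob (by omega) q h0 h1).trans (hF.trans ?_)
    simp
  | succ s ih =>
    intro m q h0 h1 hm hn hε hexp hF
    rw [Nat.mul_succ] at hm hF
    have hkm : k ≤ m := by omega
    have hn1 := (one_le_gaussBinom hkm).trans hn
    have hF0 : 0 ≤ F := le_trans (mul_nonneg (by positivity)
      (pow_nonneg (Real.sqrt_nonneg _) _)) hF
    have hchild := ih (m - k) (crossoverI q k) (crossover_pos h0 h1 k) (crossover_lt_half h1 k)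
      (by omega) ((gaussBinom_mono (Nat.sub_le m k)).trans hn)
    rw [coe_crossoverI, one_sub_two_mul_crossover, ← pow_mul, ← pow_add, crossover_crossover,
      show m - k - k * s = m - (k * s + k) by omega, show k + k * s = k * s + k by omega] at hchild
    have hchild := hchild hε (fun i hi => by
      have := hexp (i + 1) (by omega)
      rw [crossover_crossover, show k + k * i = k * (i + 1) by ring,
        show m - k - k * i = m - k * (i + 1) by rw [Nat.mul_succ]; omega]
      exact this) hF
    have hsub : {Y | decode idx dec Miter (s + 1) m Y ≠ 0} ⊆
        (⋃ B : KSub k m, proj idx B ⁻¹' {Y | decode idx dec Miter s (m - k) Y ≠ 0}) ∪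
          ⋃ x : Bits m, {Y | vote idx x Y ≤ 0} := by
      intro Y hY
      by_contra hcon
      simp only [Set.mem_union, Set.mem_iUnion, Set.mem_preimage, Set.mem_ofPred_eq, not_or,
        not_exists, not_not, not_le] at hcon
      exact hY (decode_succ_eq_zero idx hdec hM hkm hcon.1 hcon.2)
    have hvote : ∀ x : Bits m, (bscLaw m q).real {Y | vote idx x Y ≤ 0} ≤ e := by
      intro x
      -- The mean of a vote is at least the bias at the leaves, the smallest bias in the subtree.
      have h2 : 2 ^ k - 1 ≤ 2 ^ (k * (s + 1)) :=
        (Nat.sub_le _ _).trans (Nat.pow_le_pow_right (by norm_num) (Nat.le_mul_of_pos_right k (by omega)))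
      have h3 := vote_nonpos_prob idx hkm x q h0 h1 hε0
        (hε.trans (pow_le_pow_of_le_one (by linarith) (by linarith) h2))
      have h4 := hexp 0 (by omega)
      rw [mul_zero, crossover_zero, Nat.sub_zero] at h4
      exact h3.trans h4
    have hproj : ∀ B : KSub k m, (bscLaw m q).real
        (proj idx B ⁻¹' {Y | decode idx dec Miter s (m - k) Y ≠ 0}) ≤
        n ^ s * F + s * n ^ (s - 1) * 2 ^ (m - k) * e := by
      intro B
      rw [← map_measureReal_apply (measurable_of_finite _) (Set.toFinite _).measurableSet,
        map_proj idx B q (crossoverI q k) (one_sub_two_mul_crossover _ _)]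
      exact hchild
    have hpow : s * n ^ (s - 1) * n = s * n ^ s := by
      cases s with
      | zero => simp
      | succ t => rw [Nat.add_sub_cancel, pow_succ]; ring
    have hn0 : 0 ≤ n := by linarith
    have h2m : (2 : ℝ) ^ (m - k) ≤ 2 ^ m := pow_le_pow_right₀ (by norm_num) (Nat.sub_le m k)
    have hns : 1 ≤ n ^ s := one_le_pow₀ hn1
    calc (bscLaw m q).real {Y | decode idx dec Miter (s + 1) m Y ≠ 0}
        ≤ _ := (measureReal_mono hsub).trans (measureReal_union_le _ _)
      _ ≤ (∑ B : KSub k m, (n ^ s * F + s * n ^ (s - 1) * 2 ^ (m - k) * e)) + ∑ x : Bits m, e :=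
          add_le_add
            ((measureReal_iUnion_fintype_le _).trans (Finset.sum_le_sum fun B _ => hproj B))
            ((measureReal_iUnion_fintype_le _).trans (Finset.sum_le_sum fun x _ => hvote x))
      _ = gaussBinom k m * (n ^ s * F + s * n ^ (s - 1) * 2 ^ (m - k) * e) + 2 ^ m * e := by
          rw [Finset.sum_const, Finset.sum_const, Finset.card_univ, Finset.card_univ,
            ← Nat.card_eq_fintype_card (α := KSub k m), nsmul_eq_mul, nsmul_eq_mul, card_kSub]
          simp
      _ ≤ n * (n ^ s * F + s * n ^ (s - 1) * 2 ^ m * e) + n ^ s * (2 ^ m * e) := by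
          have := le_mul_of_one_le_left (show 0 ≤ 2 ^ m * e by positivity) hns
          gcongr
      _ = _ := by
          rw [Nat.add_sub_cancel]
          push_cast
          linear_combination (2 ^ m * e) * hpow

end Decoder

/-! ### Paths in the projection tree -/

section Path

variable {k m : ℕ}

lemma ProjPath.dim_eq {t m' : ℕ} (P : ProjPath k m t m') : m' = m - k * t := by
  induction P with
  | root => simp
  | snoc P S ih => rw [ih, Nat.mul_succ, Nat.sub_sub]

lemma ProjPath.map_proj (idx : CosetIndexing k) (q : unitInterval) {t m' : ℕ}
    (P : ProjPath k m t m') :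
    (bscLaw m q).map (P.proj idx) = bscLaw m' (crossoverI q (k * t)) := by
  induction P with
  | root =>
    have : crossoverI q (k * 0) = q := Subtype.ext (by rw [coe_crossoverI, mul_zero, crossover_zero])
    rw [this]
    exact Measure.map_id
  | @snoc t _ P S ih =>
    have h := RPA.map_proj idx S (crossoverI q (k * t)) (crossoverI q (k * (t + 1)))
      (by rw [coe_crossoverI, coe_crossoverI, ← one_sub_two_mul_crossover, crossover_crossover,
        Nat.mul_succ])
    rw [← h, ← ih, Measure.map_map (measurable_of_finite _) (measurable_of_finite _)]
    rfl

lemma allChildrenZero_prob_ge {idx : CosetIndexing k} {dec : ∀ m : ℕ, Word m → Word m}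
    (Miter : ℕ) (r : ℕ) (q : unitInterval) {t m' : ℕ} (P : ProjPath k m t m') {δ : ℝ}
    (hδ : (bscLaw (m' - k) (crossoverI q (k * (t + 1)))).real
      {Y | decode idx dec Miter ((r - 1) / k - (t + 1)) (m' - k) Y ≠ 0} ≤ δ) :
    1 - gaussBinom k m' * δ ≤
      (bscLaw m q).real (allChildrenZero idx dec Miter r (t + 1) P) := by
  have hS : ∀ S : KSub k m', (bscLaw m q).real ((P.snoc S).proj idx ⁻¹'
      {Y | decode idx dec Miter ((r - 1) / k - (t + 1)) (m' - k) Y ≠ 0}) ≤ δ := by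
    intro S
    rwa [← map_measureReal_apply (measurable_of_finite _) (Set.toFinite _).measurableSet,
      ProjPath.map_proj]
  have hcompl : (allChildrenZero idx dec Miter r (t + 1) P)ᶜ = ⋃ S : KSub k m',
      (P.snoc S).proj idx ⁻¹'
        {Y | decode idx dec Miter ((r - 1) / k - (t + 1)) (m' - k) Y ≠ 0} := by
    ext Y
    simp [allChildrenZero]
  have h := probReal_compl_eq_one_sub (μ := bscLaw m q)
    (Set.toFinite (allChildrenZero idx dec Miter r (t + 1) P)).measurableSet
  have h2 : (bscLaw m q).real (allChildrenZero idx dec Miter r (t + 1) P)ᶜ ≤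
      gaussBinom k m' * δ := by
    rw [hcompl]
    refine (measureReal_iUnion_fintype_le _).trans ((Finset.sum_le_sum fun S _ => hS S).trans
      (le_of_eq ?_))
    rw [Finset.sum_const, Finset.card_univ, ← Nat.card_eq_fintype_card, nsmul_eq_mul, card_kSub]
  linarith

end Path

/-! ### Numerical comparison and assembly of the bound -/

lemma blockLength_eq {m i : ℕ} (h : i ≤ m) : blockLength m i = 2 ^ (m - i) := by
  rw [blockLength, pow_sub₀ _ (by norm_num) h, div_eq_mul_inv]

/-- The numerical comparison behind the union bound: a leaf contribution quadratic in `e` is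
absorbed as soon as the bound is not trivial. -/
lemma union_bound_absorb {n D e : ℝ} {s : ℕ} (hs : 1 ≤ s) (hn : 1 ≤ n) (hD : 1 ≤ D) (he : 0 ≤ e)
    (hX : 2 ^ (s + 4) * n ^ s * D ^ 2 * e ≤ 1) :
    n * (n ^ s * (2 * D * e ^ 2) + s * n ^ (s - 1) * D * e) ≤ 2 ^ (s + 4) * n ^ s * D ^ 2 * e := by
  obtain ⟨t, rfl⟩ : ∃ t, s = t + 1 := ⟨s - 1, by omega⟩
  rw [Nat.add_sub_cancel]
  set a := n ^ (t + 1) with ha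
  have hna : n ≤ a := le_self_pow₀ hn (by omega)
  have hat : n ^ t * n = a := (pow_succ n t).symm
  have h2 : ((t + 1 : ℕ) : ℝ) ≤ 2 ^ (t + 1) := by exact_mod_cast Nat.lt_two_pow_self.le
  have hp : (1 : ℝ) ≤ 2 ^ (t + 1) := one_le_pow₀ (by norm_num)
  set w : ℝ := 2 ^ (t + 1) with hw
  have ha1 : 1 ≤ a := hn.trans hna
  rw [pow_add _ (t + 1) 4, ← hw] at hX ⊢
  have hDD : D ≤ D ^ 2 := by nlinarith
  -- One of the two factors e in the leaf term pays for the surplus n and for 2 * D.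
  have k1 : n * (2 * D * e) ≤ 1 := by
    calc n * (2 * D * e) ≤ a * (2 * D ^ 2 * e) := by gcongr
      _ = 2 * (1 * (a * D ^ 2 * e)) := by ring
      _ ≤ 2 ^ 4 * (w * (a * D ^ 2 * e)) := by gcongr; norm_num
      _ = w * 2 ^ 4 * a * D ^ 2 * e := by ring
      _ ≤ 1 := hX
  calc n * (a * (2 * D * e ^ 2) + (t + 1 : ℕ) * n ^ t * D * e)
      = a * e * (n * (2 * D * e)) + (t + 1 : ℕ) * (n ^ t * n) * D * e := by ring
    _ ≤ a * e * 1 + w * a * D ^ 2 * e := by rw [hat]; gcongr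
    _ = (1 * 1 + w * D ^ 2) * (a * e) := by ring
    _ ≤ (w * D ^ 2 + w * D ^ 2) * (a * e) := by
        gcongr
        nlinarith
    _ = 2 * (w * D ^ 2 * (a * e)) := by ring
    _ ≤ 2 ^ 4 * (w * D ^ 2 * (a * e)) := by gcongr; norm_num
    _ = _ := by ring

end RPA

theorem theorem7 (k m r : ℕ) (hk : 1 ≤ k) (hkr : k ∣ r - 1) (hrm : r ≤ m)
    (p : unitInterval) (hp0 : 0 < (p : ℝ)) (hp : (p : ℝ) < 1 / 2)
    (idx : RPA.CosetIndexing k) (dec : ∀ m : ℕ, RPA.Word m → RPA.Word m)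
    (hdec : RPA.IsMLDecoder dec) (Miter : ℕ) (hM : 1 ≤ Miter)
    (j : ℕ) (hj : j ∈ Finset.Icc 1 ((r - k - 1) / k))
    (ε : ℝ) (hε0 : 0 < ε) (hε : ε < RPA.etaBar (RPA.crossover p (r - 1)))
    (m' : ℕ) (P : RPA.ProjPath k m (j - 1) m') :
    1 - (2 : ℝ) ^ (((k : ℝ) * (4 - (j : ℝ)) + (r : ℝ) - 1) / (k : ℝ))
        * RPA.gaussBinom k m ^ (((r : ℝ) - 1 - (k : ℝ) * (j : ℝ)) / (k : ℝ))
        * RPA.blockLength m (k * j) ^ 2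
        * Real.exp (-(Real.log ((1 - RPA.crossover p (r - k - 1)) / RPA.crossover p (r - k - 1))
            * 2 ^ (-2 * (k : ℤ) - 2) * RPA.blockLength m (r - k - 1) * ε ^ 2))
      ≤ (RPA.bscLaw m p).real (RPA.allChildrenZero idx dec Miter r j P) := by
  obtain ⟨hj1, hj2⟩ := Finset.mem_Icc.1 hj
  obtain ⟨t, rfl⟩ : ∃ t, j = t + 1 := ⟨j - 1, by omega⟩
  obtain ⟨R, hR⟩ := hkr
  -- Truncated subtraction would allow r = 0, but then the range of j is empty.
  have hr1 : r = k * R + 1 := by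
    rcases Nat.eq_zero_or_pos r with h | h
    · subst h; simp at hj2
    · omega
  subst hr1
  have hR1 : (k * R + 1 - k - 1) / k = R - 1 := by
    rw [show k * R + 1 - k - 1 = k * (R - 1) by rw [Nat.mul_sub, mul_one]; omega,
      Nat.mul_div_cancel_left _ hk]
  rw [hR1] at hj2
  -- The children of the node have u + 1 aggregation levels above their leaves; the deepest one sits
  -- at projection depth k (t + 1 + u) = r - k - 1.
  obtain ⟨u, rfl⟩ : ∃ u, R = t + 1 + (u + 1) := ⟨R - t - 2, by omega⟩
  have hlast : k * (t + 1 + (u + 1)) + 1 - k - 1 = k * (t + 1 + u) := by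
    rw [show k * (t + 1 + (u + 1)) = k * (t + 1 + u) + k by ring]; omega
  have hsplit : k * (t + 1 + (u + 1)) = k * (t + 1) + k * u + k := by ring
  have hk0 : (k : ℝ) ≠ 0 := by exact_mod_cast (by omega : k ≠ 0)
  have hexp1 : ((k : ℝ) * (4 - ((t + 1 : ℕ) : ℝ)) + ((k * (t + 1 + (u + 1)) + 1 : ℕ) : ℝ) - 1) / k =
      ((u + 1 + 4 : ℕ) : ℝ) := by
    field_simp; push_cast; ring
  have hexp2 : (((k * (t + 1 + (u + 1)) + 1 : ℕ) : ℝ) - 1 - (k : ℝ) * ((t + 1 : ℕ) : ℝ)) / k =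
      ((u + 1 : ℕ) : ℝ) := by
    field_simp; push_cast; ring
  rw [hexp1, hexp2, Real.rpow_natCast, Real.rpow_natCast, hlast,
    RPA.blockLength_eq (by omega : k * (t + 1) ≤ m),
    RPA.blockLength_eq (by rw [mul_add k (t + 1) u]; omega : k * (t + 1 + u) ≤ m)]
  change 1 - _ * Real.exp (-(RPA.llr (RPA.crossover p (k * (t + 1 + u))) * _ * _ * _)) ≤ _
  set q := RPA.crossover p (k * (t + 1 + u)) with hq
  have hq0 : 0 < q := RPA.crossover_pos hp0 hp _
  have hq1 : q < 1 / 2 := RPA.crossover_lt_half hp _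
  set e := Real.exp (-(RPA.llr q * 2 ^ (-2 * (k : ℤ) - 2) * 2 ^ (m - k * (t + 1 + u)) * ε ^ 2))
    with he
  set D : ℝ := 2 ^ (m - k * (t + 1)) with hD
  set n := RPA.gaussBinom k m with hn
  have he0 : 0 ≤ e := (Real.exp_pos _).le
  have hD1 : 1 ≤ D := one_le_pow₀ (by norm_num)
  have hn1 : 1 ≤ n := RPA.one_le_gaussBinom (by omega)
  have hm' : m' = m - k * t := P.dim_eq
  have hm'k : m' - k = m - k * (t + 1) := by rw [hm', Nat.mul_succ]; omega
  -- If the subtracted term is at least 1, nothing is left to prove; otherwise its smallness drives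
  -- the absorption.
  rcases le_or_gt 1 (2 ^ (u + 1 + 4) * n ^ (u + 1) * D ^ 2 * e) with htriv | hX
  · exact (sub_nonpos.2 htriv).trans measureReal_nonneg
  have hε' : 2 * ε ≤ (1 - 2 * (p : ℝ)) ^ 2 ^ (k * (t + 1 + (u + 1))) := by
    have h := RPA.one_sub_two_mul_crossover (p : ℝ) (k * (t + 1 + (u + 1)))
    rw [RPA.etaBar, Nat.add_sub_cancel] at hε
    linarith
  have hleaf := RPA.chernoff_crossover_pow_le hq0 hq1 hk (m - k * (t + 1 + (u + 1)) - 1) hε0.le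
    (by
      rw [hq, RPA.one_sub_two_mul_crossover, ← pow_mul, ← pow_add,
        show k * (t + 1 + u) + k = k * (t + 1 + (u + 1)) by ring]
      exact hε')
  rw [show m - k * (t + 1 + (u + 1)) - 1 + 1 + k = m - k * (t + 1 + u) by omega, ← he, hq,
    RPA.crossover_crossover, show k * (t + 1 + u) + k = k * (t + 1 + (u + 1)) by ring] at hleaf
  have hfail := RPA.decode_fail_prob idx hdec hM (ε := ε) (e := e) (F := 2 * D * e ^ 2) (n := n)
    hε0.le he0 (u + 1) (m - k * (t + 1)) (RPA.crossoverI p (k * (t + 1)))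
    (RPA.crossover_pos hp0 hp _) (RPA.crossover_lt_half hp _)
    (by rw [Nat.mul_succ]; omega) (RPA.gaussBinom_mono (Nat.sub_le _ _))
    (by
      rw [RPA.coe_crossoverI, RPA.one_sub_two_mul_crossover, ← pow_mul, ← pow_add, ← Nat.mul_add]
      exact hε')
    (by
      intro i hi
      rw [RPA.coe_crossoverI, RPA.crossover_crossover, ← Nat.mul_add]
      have hle : k * (t + 1 + i) ≤ k * (t + 1 + u) := Nat.mul_le_mul_left k (by omega)
      -- Both the log-likelihood ratio and the block length shrink with depth, so e, taken at the
      -- deepest level, dominates every vote failure.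
      have h1 : RPA.llr q ≤ RPA.llr (RPA.crossover p (k * (t + 1 + i))) :=
        RPA.llr_anti (RPA.crossover_pos hp0 hp _) (RPA.crossover_mono hp0 hp hle) hq1
      have h2 : (2 : ℝ) ^ (m - k * (t + 1 + u)) ≤ 2 ^ (m - k * (t + 1) - k * i) :=
        pow_le_pow_right₀ (by norm_num) (by rw [Nat.sub_sub, ← Nat.mul_add]; omega)
      have h3 := RPA.llr_pos hq0 hq1
      refine Real.exp_le_exp.2 (neg_le_neg ?_)
      have h4 := h3.trans_le h1
      gcongr)
    (by
      rw [RPA.coe_crossoverI, RPA.crossover_crossover, ← Nat.mul_add, Nat.sub_sub, ← Nat.mul_add]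
      have h1 : (2 : ℝ) ^ (m - k * (t + 1 + (u + 1)) + 1) ≤ 2 * D := by
        rw [hD, ← pow_succ']
        exact pow_le_pow_right₀ (by norm_num) (by omega)
      exact mul_le_mul h1 hleaf (pow_nonneg (Real.sqrt_nonneg _) _) (by positivity))
  have hs : (k * (t + 1 + (u + 1)) + 1 - 1) / k - (t + 1) = u + 1 := by
    rw [Nat.add_sub_cancel, Nat.mul_div_cancel_left _ hk]; omega
  rw [← hs, ← hm'k] at hfail
  have hmain := RPA.allChildrenZero_prob_ge Miter _ p P hfail
  rw [hs] at hmain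
  refine le_trans (sub_le_sub_left ?_ 1) hmain
  refine le_trans (mul_le_mul_of_nonneg_right
    (RPA.gaussBinom_mono (by omega : m' ≤ m)) (by positivity)) ?_
  rw [hm'k]
  exact RPA.union_bound_absorb (by omega) hn1 hD1 he0 hX.le
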